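/- For a positive integer $k$ let $P_k$ denote the path on $k$ vertices, and let $\mathrm{ex}(n,P_k)$ be the maximum number of edges of a simple graph on $n$ vertices that contains no copy of $P_k$. Let $k\ge 2$ and $c\ge 1$ be integers and put $t=\lfloor k/2\rfloor$. Then there is $N=N(k,c)$ such that the following holds for every $n\ge N$. Let $G$ be a simple graph on $n$ vertices, not necessarily connected, that contains no copy of $P_k$ and satisfies $$e(G)\ \ge\ \mathrm{ex}(n,P_k)-c ,$$ where $e(G)$ is the number of edges of $G$, and let $$s=\left\lceil \min\left\{\frac{n}{16c},\ \frac{n}{2k-2}\right\}\right\rceil .$$ Then $G$ contains, as a not necessarily induced subgraph, a copy of the complete bipartite graph $K_{t-1,s}$ with class sizes $t-1$ and $s$, or a copy of $sK_{k-1}$, the vertex-disjoint union of $s$ copies of the complete graph on $k-1$ vertices. (If $t=1$, then $K_{0,s}$ is the graph with $s$ vertices and no edges.) -/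

import Mathlib

namespace SimpleGraph

/-- The vertex-disjoint union of `s` copies of a graph `H`: the vertex `(i, v)` is the vertex `v`
in the `i`-th copy, and edges only run inside a copy. -/
def disjointCopies {V : Type*} (s : ℕ) (H : SimpleGraph V) : SimpleGraph (Fin s × V) where
  Adj x y := x.1 = y.1 ∧ H.Adj x.2 y.2
  symm := ⟨fun _ _ h => ⟨h.1.symm, h.2.symm⟩⟩
  loopless := ⟨fun _ h => h.2.ne rfl⟩

end SimpleGraph

/-! Write `κ = k - 2` and call `κ|X| - adjCount X X` the deficiency of `X`; `adjCount X X` is twice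
the number of edges. Deficiency is additive over components and nonnegative by Erdős–Gallai
(`PathFree.adjCount_le`). Disjoint copies of `K_{κ+1}` and one smaller clique bound `ex(n, P_k)`
from below, so the deficiency of `G` is at most a constant `D` depending on `k` and `c`. A component
of deficiency 0 is a `K_{κ+1}` (`IsConn.card_eq_of_mul_card_le`), so it suffices to find `s` such
tight components or a `K_{⌊κ/2⌋,s}`.

For odd `κ` a non-tight component has deficiency at least `|C|/(κ+2)` (`IsConn.card_le_of_odd`), so
all but boundedly many vertices lie in tight components.

For `κ = 2a` with `a ≥ 1`, non-tight components of bounded size again cover boundedly many vertices.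
A large one is, by `exists_complete_of_deficiency_le`, an `a`-set `A` plus an independent set,
nearly all of it completely joined to `A`. Such a component has deficiency at least `a(a+1)`, while
`D = 2c + a(a+1)`, so there are at most `c + 1 ≤ 2c` of them. With fewer than `s` tight components,
about half of the vertices lie in these few components, and one of them is large enough to contain
`K_{a,s}`.

The structure of a large component comes from a bounded set `S` whose removal leaves many
components. By pigeonhole many of these have the same neighbourhood `A` in `S`; threading a path
through `A` and these components shows that they are single vertices and `|A| = a`. -/

open Finset

set_option linter.unusedSectionVars false

namespace SimpleGraph

/-! ### Edge counts, paths as vertex lists, and components of induced subgraphs -/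

section PathLists

variable {V : Type*} [DecidableEq V] (G : SimpleGraph V) [DecidableRel G.Adj]

/-- The number of ordered pairs `(x, y)` of adjacent vertices with `x ∈ X` and `y ∈ Y`. -/
def adjCount (X Y : Finset V) : ℕ := ∑ x ∈ X, ∑ y ∈ Y, if G.Adj x y then 1 else 0

/-- `X` induces a nonempty connected subgraph. -/
def IsConn (X : Finset V) : Prop :=
  X.Nonempty ∧ ∀ A ⊆ X, A.Nonempty → (∀ a ∈ A, ∀ b ∈ X, G.Adj a b → b ∈ A) → A = X

/-- `l` is the vertex list of a path all of whose vertices are in `X`. -/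
def IsPathList (X : Finset V) (l : List V) : Prop :=
  l.Nodup ∧ l.IsChain G.Adj ∧ ∀ v ∈ l, v ∈ X

/-- The subgraph induced by `X` contains no path on `k` vertices. -/
def PathFree (k : ℕ) (X : Finset V) : Prop := ∀ l, G.IsPathList X l → l.length < k

/-- `C` is the vertex set of a connected component of the subgraph induced by `X`. -/
def IsComp (X C : Finset V) : Prop :=
  C ⊆ X ∧ G.IsConn C ∧ ∀ a ∈ C, ∀ b ∈ X, G.Adj a b → b ∈ C

open Classical in
/-- The components of the subgraph induced by `X`. -/
noncomputable def comps (X : Finset V) : Finset (Finset V) := X.powerset.filter (G.IsComp X)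

variable {G} {X Y Z A B C : Finset V} {k : ℕ}

lemma adjCount_comm : G.adjCount X Y = G.adjCount Y X := by
  unfold adjCount
  rw [sum_comm]
  simp only [G.adj_comm]

lemma adjCount_union_left (h : Disjoint X Y) :
    G.adjCount (X ∪ Y) Z = G.adjCount X Z + G.adjCount Y Z := sum_union h

lemma adjCount_union_right (h : Disjoint X Y) :
    G.adjCount Z (X ∪ Y) = G.adjCount Z X + G.adjCount Z Y := by
  rw [adjCount_comm, adjCount_union_left h, adjCount_comm, G.adjCount_comm (X := Y)]

lemma adjCount_eq_zero (h : ∀ x ∈ X, ∀ y ∈ Y, ¬ G.Adj x y) : G.adjCount X Y = 0 :=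
  sum_eq_zero fun x hx => sum_eq_zero fun y hy => if_neg (h x hx y hy)

lemma adjCount_union_self (h : Disjoint X Y) :
    G.adjCount (X ∪ Y) (X ∪ Y) = G.adjCount X X + 2 * G.adjCount X Y + G.adjCount Y Y := by
  rw [adjCount_union_left h, adjCount_union_right h, adjCount_union_right h,
    G.adjCount_comm (X := Y) (Y := X)]
  ring

lemma adjCount_singleton_left (x : V) : G.adjCount {x} Y = #(Y.filter (G.Adj x)) := by
  simp [adjCount]

lemma adjCount_eq_sum : G.adjCount X Y = ∑ x ∈ X, #(Y.filter (G.Adj x)) := by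
  simp [adjCount]

lemma adjCount_singleton_self (x : V) : G.adjCount {x} {x} = 0 := by
  simp [adjCount]

lemma adjCount_le_mul : G.adjCount X Y ≤ #X * #Y := by
  rw [adjCount_eq_sum]
  exact sum_le_card_nsmul _ _ _ fun x _ => card_filter_le _ _

lemma adjCount_self_add_card_le : G.adjCount X X + #X ≤ #X * #X := by
  rw [adjCount_eq_sum, card_eq_sum_ones, ← sum_add_distrib, ← card_eq_sum_ones, ← smul_eq_mul]
  refine sum_le_card_nsmul _ _ _ fun x hx => ?_
  have : X.filter (G.Adj x) ⊆ X.erase x := fun y hy => by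
    simp only [mem_filter, mem_erase] at hy ⊢
    exact ⟨hy.2.ne', hy.1⟩
  have h2 := card_le_card this
  have := card_erase_add_one hx
  omega

lemma adjCount_erase {x : V} (hx : x ∈ X) :
    G.adjCount X X = G.adjCount (X.erase x) (X.erase x) + 2 * #((X.erase x).filter (G.Adj x)) := by
  have h : Disjoint {x} (X.erase x) := by simp
  have e : {x} ∪ X.erase x = X := by rw [← insert_eq, insert_erase hx]
  have := G.adjCount_union_self h
  rw [e, adjCount_singleton_self, adjCount_singleton_left] at this
  omega

lemma filter_adj_erase (x : V) : (X.erase x).filter (G.Adj x) = X.filter (G.Adj x) := by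
  ext y
  simp only [mem_filter, mem_erase]
  exact ⟨fun h => ⟨h.1.2, h.2⟩, fun h => ⟨⟨h.2.ne', h.1⟩, h.2⟩⟩

lemma IsPathList.mono {l : List V} (h : G.IsPathList X l) (hXY : X ⊆ Y) : G.IsPathList Y l :=
  ⟨h.1, h.2.1, fun v hv => hXY (h.2.2 v hv)⟩

lemma PathFree.mono (h : G.PathFree k Y) (hXY : X ⊆ Y) : G.PathFree k X :=
  fun l hl => h l (hl.mono hXY)

lemma IsPathList.reverse {l : List V} (h : G.IsPathList X l) : G.IsPathList X l.reverse := by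
  refine ⟨List.nodup_reverse.2 h.1, ?_, by simpa using h.2.2⟩
  rw [List.isChain_reverse]
  simpa only [G.adj_comm] using h.2.1

lemma IsPathList.append {l m : List V} (hl : G.IsPathList X l) (hm : G.IsPathList Y m)
    (hXY : Disjoint X Y) (h : ∀ x ∈ l.getLast?, ∀ y ∈ m.head?, G.Adj x y) :
    G.IsPathList (X ∪ Y) (l ++ m) := by
  refine ⟨?_, ?_, ?_⟩
  · rw [List.nodup_append']
    exact ⟨hl.1, hm.1, fun a ha hb => Finset.disjoint_left.1 hXY (hl.2.2 a ha) (hm.2.2 a hb)⟩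
  · rw [List.isChain_append]
    exact ⟨hl.2.1, hm.2.1, h⟩
  · intro v hv
    rw [List.mem_append] at hv
    rw [mem_union]
    exact hv.imp (hl.2.2 v) (hm.2.2 v)

lemma IsPathList.cons {x : V} {l : List V} (hl : G.IsPathList X l) (hx : x ∉ X)
    (h : ∀ y ∈ l.head?, G.Adj x y) : G.IsPathList (insert x X) (x :: l) := by
  have : G.IsPathList {x} [x] := ⟨by simp, by simp, by simp⟩
  have := this.append hl (by simpa using hx) (by simpa using h)
  rwa [← insert_eq] at this

lemma IsPathList.singleton {x : V} (hx : x ∈ X) : G.IsPathList X [x] := by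
  simpa [IsPathList] using hx

lemma IsConn.nonempty (h : G.IsConn X) : X.Nonempty := h.1

lemma IsConn.exists_adj (h : G.IsConn X) (hA : A ⊆ X) (hne : A.Nonempty) (hAX : A ≠ X) :
    ∃ a ∈ A, ∃ b ∈ X, b ∉ A ∧ G.Adj a b := by
  by_contra! hc
  exact hAX (h.2 A hA hne fun a ha b hb hab => by_contra fun hbA => hc a ha b hb hbA hab)

lemma IsComp.eq_of_inter (hA : G.IsComp X A) (hB : G.IsComp X B) (h : (A ∩ B).Nonempty) :
    A = B := by
  have h1 := hA.2.1.2 (A ∩ B) inter_subset_left h fun a ha b hb hab => by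
    rw [mem_inter] at ha ⊢
    exact ⟨hb, hB.2.2 a ha.2 b (hA.1 hb) hab⟩
  have h2 := hB.2.1.2 (A ∩ B) inter_subset_right h fun a ha b hb hab => by
    rw [mem_inter] at ha ⊢
    exact ⟨hA.2.2 a ha.1 b (hB.1 hb) hab, hb⟩
  exact h1.symm.trans h2

lemma mem_comps : C ∈ G.comps X ↔ G.IsComp X C := by
  simp only [comps, mem_filter, mem_powerset, and_iff_right_iff_imp]
  exact fun h => h.1

lemma comps_pairwiseDisjoint : (G.comps X : Set (Finset V)).PairwiseDisjoint id := by
  intro A hA B hB hAB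
  by_contra h
  rw [Function.onFun, id, id, disjoint_iff_inter_eq_empty, ← ne_eq, ← nonempty_iff_ne_empty] at h
  exact hAB ((mem_comps.1 hA).eq_of_inter (mem_comps.1 hB) h)

/-- Take a smallest closed set containing `x`. A nonempty closed proper subset, or its complement if
it misses `x`, would be a smaller one. -/
lemma exists_isComp_mem {x : V} (hx : x ∈ X) : ∃ C, G.IsComp X C ∧ x ∈ C := by
  classical
  have hne : (X.powerset.filter fun C => x ∈ C ∧
      ∀ a ∈ C, ∀ b ∈ X, G.Adj a b → b ∈ C).Nonempty :=
    ⟨X, by simpa using ⟨hx, fun a _ b hb _ => hb⟩⟩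
  obtain ⟨C, hC, hmin⟩ := exists_min_image _ card hne
  simp only [mem_filter, mem_powerset] at hC hmin
  obtain ⟨hCX, hxC, hcl⟩ := hC
  refine ⟨C, ⟨hCX, ⟨⟨x, hxC⟩, fun A hA hne hAcl => ?_⟩, hcl⟩, hxC⟩
  by_cases hxA : x ∈ A
  · refine eq_of_subset_of_card_le hA (hmin A ⟨hA.trans hCX, hxA, fun a ha b hb hab => ?_⟩)
    exact hAcl a ha b (hcl a (hA ha) b hb hab) hab
  · have := hmin (C \ A) ⟨sdiff_subset.trans hCX, by simp [hxC, hxA], fun a ha b hb hab => ?_⟩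
    · have h1 := card_sdiff_add_card_eq_card hA
      have := hne.card_pos
      omega
    · rw [mem_sdiff] at ha ⊢
      exact ⟨hcl a ha.1 b hb hab, fun hbA => ha.2 (hAcl b hbA a ha.1 hab.symm)⟩

lemma biUnion_comps : (G.comps X).biUnion id = X := by
  ext x
  simp only [mem_biUnion, id, mem_comps]
  exact ⟨fun ⟨C, hC, hx⟩ => hC.1 hx, fun hx => exists_isComp_mem hx⟩

lemma sum_card_comps : ∑ C ∈ G.comps X, #C = #X := by
  conv_rhs => rw [← G.biUnion_comps (X := X)]
  rw [card_biUnion fun A hA B hB h => comps_pairwiseDisjoint hA hB h]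
  rfl

lemma adjCount_biUnion_left {F : Finset (Finset V)}
    (hF : (F : Set (Finset V)).PairwiseDisjoint id) :
    G.adjCount (F.biUnion id) Y = ∑ C ∈ F, G.adjCount C Y := by
  unfold adjCount
  rw [sum_biUnion hF]
  rfl

lemma adjCount_eq_of_closed (hY : Y ⊆ Z) (h : ∀ x ∈ X, ∀ z ∈ Z, G.Adj x z → z ∈ Y) :
    G.adjCount X Z = G.adjCount X Y := by
  simp only [adjCount_eq_sum]
  refine sum_congr rfl fun x hx => congrArg card ?_
  ext z
  simp only [mem_filter]
  exact ⟨fun hz => ⟨h x hx z hz.1 hz.2, hz.2⟩, fun hz => ⟨hY hz.1, hz.2⟩⟩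

lemma sum_adjCount_comps : ∑ C ∈ G.comps X, G.adjCount C C = G.adjCount X X := by
  conv_rhs => rw [← G.biUnion_comps (X := X), adjCount_biUnion_left comps_pairwiseDisjoint,
    biUnion_comps]
  refine sum_congr rfl fun C hC => ?_
  rw [mem_comps] at hC
  exact (adjCount_eq_of_closed hC.1 hC.2.2).symm

end PathLists

/-! ### The Erdős–Gallai theorem by rotation and deletion of low-degree vertices -/

section ErdosGallai

variable {V : Type*} [DecidableEq V] {G : SimpleGraph V} [DecidableRel G.Adj]
  {X Y Z A B C : Finset V} {k κ : ℕ}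

lemma PathFree.exists_longest (h : G.PathFree k X) {p : List V → Prop}
    (hp : ∃ l, G.IsPathList X l ∧ p l) :
    ∃ l, G.IsPathList X l ∧ p l ∧ ∀ m, G.IsPathList X m → p m → m.length ≤ l.length := by
  classical
  let P : ℕ → Prop := fun n => ∃ l, G.IsPathList X l ∧ p l ∧ l.length = n
  obtain ⟨l₀, hl₀, hp₀⟩ := hp
  obtain ⟨l, hl, hpl, hn⟩ : P (Nat.findGreatest P k) :=
    Nat.findGreatest_spec (h l₀ hl₀).le ⟨l₀, hl₀, hp₀, rfl⟩
  refine ⟨l, hl, hpl, fun m hm hpm => ?_⟩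
  rw [hn]
  exact Nat.le_findGreatest (h m hm).le ⟨m, hm, hpm, rfl⟩

/-- Opening a cycle at a vertex with a neighbour `y` outside it gives a longer path. -/
lemma IsPathList.exists_of_cycle {c : List V} (hc : G.IsPathList X c)
    (hcyc : ∀ x ∈ c.getLast?, ∀ y ∈ c.head?, G.Adj x y) {x y : V} (hx : x ∈ c) (hy : y ∈ X)
    (hyc : y ∉ c) (hxy : G.Adj x y) :
    ∃ l, G.IsPathList X l ∧ l.length = c.length + 1 := by
  obtain ⟨c₁, c₂, rfl⟩ := List.append_of_mem hx
  refine ⟨y :: (x :: c₂ ++ c₁), ⟨?_, ?_, ?_⟩, by simp; omega⟩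
  · rw [List.nodup_cons]
    refine ⟨fun h => hyc ?_, List.nodup_append_comm.1 hc.1⟩
    simp only [List.mem_append] at h ⊢
    exact h.symm
  · rw [List.cons_append, List.isChain_cons_cons, ← List.cons_append, List.isChain_append]
    have h := hc.2.1
    rw [List.isChain_append] at h
    refine ⟨hxy.symm, h.2.1, h.1, fun a ha b hb => hcyc a ?_ b ?_⟩
    · rw [List.getLast?_append_of_ne_nil _ (by simp)]
      exact ha
    · cases c₁ <;> simp_all
  · intro v hv
    rcases List.mem_cons.1 hv with rfl | hv
    · exact hy
    · refine hc.2.2 v ?_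
      simp only [List.mem_append] at hv ⊢
      exact hv.symm

/-- Pósa's rotation: two crossing chords from the ends of a path give a cycle on its vertices. -/
lemma IsPathList.exists_cycle {l : List V} (hl : G.IsPathList X l) {i : ℕ}
    (hi : i + 1 < l.length) (h₁ : G.Adj (l[0]'(by omega)) l[i + 1])
    (h₂ : G.Adj (l[l.length - 1]'(by omega)) l[i]) :
    ∃ c, G.IsPathList X c ∧ c.Perm l ∧ ∀ x ∈ c.getLast?, ∀ y ∈ c.head?, G.Adj x y := by
  -- The cycle runs from `l[0]` to `l[i]`, jumps to the last vertex, returns to `l[i + 1]` and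
  -- closes at `l[0]`.
  have hperm : (l.take (i + 1) ++ (l.drop (i + 1)).reverse).Perm l := by
    conv_rhs => rw [← List.take_append_drop (i + 1) l]
    exact (List.Perm.refl _).append (List.reverse_perm _)
  have hdrop : l.drop (i + 1) ≠ [] := by simp; omega
  refine ⟨l.take (i + 1) ++ (l.drop (i + 1)).reverse, ⟨hperm.nodup_iff.2 hl.1, ?_,
    fun v hv => hl.2.2 v (hperm.mem_iff.1 hv)⟩, hperm, ?_⟩
  · rw [List.isChain_append]
    refine ⟨hl.2.1.take _, ?_, ?_⟩
    · rw [List.isChain_reverse]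
      simpa only [G.adj_comm] using hl.2.1.drop (i + 1)
    · intro a ha b hb
      rw [List.head?_reverse] at hb
      have ha' : l[i] = a := by
        rw [List.getLast?_eq_getElem?, List.getElem?_take] at ha
        simp at ha
        rw [min_eq_left (by omega)] at ha
        simpa [List.getElem?_eq_getElem (show i < l.length by omega)] using ha
      have hb' : l[l.length - 1] = b := by
        rw [List.getLast?_drop, if_neg (by omega), List.getLast?_eq_getElem?,
          List.getElem?_eq_getElem (by omega)] at hb
        simpa using hb
      rw [← ha', ← hb']
      exact h₂.symm
  · intro a ha b hb
    rw [List.getLast?_append_of_ne_nil _ (by simpa using hdrop), List.getLast?_reverse,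
      List.head?_drop, List.getElem?_eq_getElem hi] at ha
    have hb' : l[0] = b := by
      rw [List.head?_append_of_ne_nil _ (by simp; rintro rfl; simp at hi), List.head?_take,
        if_neg (by omega), List.head?_eq_getElem?, List.getElem?_eq_getElem (by omega)] at hb
      simpa using hb
    have ha' : l[i + 1] = a := by simpa using ha
    rw [← ha', ← hb']
    exact h₁.symm

/-- Distinct vertices occupy distinct positions of `l`. The map `f` allows the positions to be
shifted, so that a pair of crossing chords becomes a common index. -/
lemma card_le_card_indices {s : Finset V} {l : List V} (hl : ∀ v ∈ s, v ∈ l) (n : ℕ) (f : ℕ → ℕ)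
    (hf : ∀ v ∈ s, ∀ j, (hj : j < l.length) → l[j] = v → ∃ i < n, f i = j) :
    #s ≤ #((range n).filter fun i => ∃ v ∈ s, l[f i]? = some v) := by
  have : ∀ v ∈ s, ∃ i ∈ (range n).filter fun i => ∃ v ∈ s, l[f i]? = some v,
      l[f i]? = some v := by
    intro v hv
    obtain ⟨j, hj, hjv⟩ := List.getElem_of_mem (hl v hv)
    obtain ⟨i, hi, rfl⟩ := hf v hv j hj hjv
    have : l[f i]? = some v := by rw [List.getElem?_eq_getElem hj, hjv]
    exact ⟨i, by simpa using ⟨hi, v, hv, this⟩, this⟩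
  choose! g hg hgv using this
  refine card_le_card_of_injOn g hg fun v hv w hw hvw => ?_
  have := hgv v hv
  rw [hvw, hgv w hw] at this
  simpa using this.symm

/-- A connected graph without a path on `κ + 2` vertices that has at least `κ + 2` vertices has
a vertex of degree at most `κ / 2`. -/
lemma IsConn.exists_two_mul_card_filter_le (hX : G.IsConn X) (hfree : G.PathFree (κ + 2) X)
    (hcard : κ + 2 ≤ #X) : ∃ x ∈ X, 2 * #(X.filter (G.Adj x)) ≤ κ := by
  by_contra! hdeg
  obtain ⟨x₀, hx₀⟩ := hX.nonempty
  obtain ⟨l, hl, hne, hmax⟩ := hfree.exists_longest (p := fun l => l ≠ [])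
    ⟨[x₀], .singleton hx₀, by simp⟩
  have hpos : 0 < l.length := List.length_pos_iff.2 hne
  have hlt := hfree l hl
  have hout : ∀ m, G.IsPathList X m → m.length ≤ l.length := fun m hm => by
    rcases eq_or_ne m [] with rfl | h
    · simp
    · exact hmax m hm h
  have hend : ∀ m, G.IsPathList X m → m.length = l.length → ∀ v ∈ X, ∀ u ∈ m.head?,
      G.Adj u v → v ∈ m := by
    intro m hm hml v hv u hu huv
    by_contra hvm
    have : G.IsPathList X (v :: m) := by
      refine ⟨List.nodup_cons.2 ⟨hvm, hm.1⟩, List.isChain_cons.2 ⟨fun y hy => ?_, hm.2.1⟩, ?_⟩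
      · have : y = u := by simp_all
        exact this ▸ huv.symm
      · intro w hw
        rcases List.mem_cons.1 hw with rfl | hw
        exacts [hv, hm.2.2 w hw]
    have := hout _ this
    simp at this
    omega
  set u := l[0] with hu
  set w := l[l.length - 1] with hw
  have hNu : ∀ v ∈ X.filter (G.Adj u), v ∈ l := fun v hv =>
    hend l hl rfl v (mem_filter.1 hv).1 u (by rw [List.head?_eq_getElem?]; simp [hu, hpos])
      (mem_filter.1 hv).2
  have hNw : ∀ v ∈ X.filter (G.Adj w), v ∈ l := fun v hv =>
    List.mem_reverse.1 <| hend l.reverse hl.reverse (by simp) v (mem_filter.1 hv).1 w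
      (by rw [List.head?_reverse, List.getLast?_eq_getElem?]; simp [hw, hpos])
      (mem_filter.1 hv).2
  have hI := card_le_card_indices hNu (l.length - 1) (· + 1) fun v hv j hj hjv => by
    have : j ≠ 0 := by
      rintro rfl
      exact (mem_filter.1 hv).2.ne hjv
    exact ⟨j - 1, by omega, by omega⟩
  have hJ := card_le_card_indices hNw (l.length - 1) id fun v hv j hj hjv => by
    have : j ≠ l.length - 1 := by
      rintro rfl
      exact (mem_filter.1 hv).2.ne hjv
    exact ⟨j, by omega, rfl⟩
  -- Both index sets have more than `κ / 2` elements and lie in a range of size `l.length - 1 ≤ κ`,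
  -- so they meet.
  obtain ⟨i, hi⟩ : (((range (l.length - 1)).filter fun i =>
      ∃ v ∈ X.filter (G.Adj u), l[i + 1]? = some v) ∩ ((range (l.length - 1)).filter fun i =>
      ∃ v ∈ X.filter (G.Adj w), l[id i]? = some v)).Nonempty := by
    rw [nonempty_iff_ne_empty]
    intro h0
    have h1 := card_union_add_card_inter ((range (l.length - 1)).filter fun i =>
      ∃ v ∈ X.filter (G.Adj u), l[i + 1]? = some v) ((range (l.length - 1)).filter fun i =>
      ∃ v ∈ X.filter (G.Adj w), l[id i]? = some v)
    have h2 := card_le_card (union_subset (filter_subset (fun i =>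
      ∃ v ∈ X.filter (G.Adj u), l[i + 1]? = some v) (range (l.length - 1))) (filter_subset
      (fun i => ∃ v ∈ X.filter (G.Adj w), l[id i]? = some v) (range (l.length - 1))))
    rw [h0, card_empty] at h1
    rw [card_range] at h2
    have h3 := hdeg u (hl.2.2 _ (by simp [hu]))
    have h4 := hdeg w (hl.2.2 _ (by simp [hw]))
    omega
  simp only [mem_inter, mem_filter, mem_range, id] at hi
  obtain ⟨⟨hi, v, ⟨hvX, huv⟩, hv⟩, -, v', ⟨hvX', hwv⟩, hv'⟩ := hi
  rw [List.getElem?_eq_getElem (by omega), Option.some.injEq] at hv hv'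
  obtain ⟨c, hc, hperm, hcyc⟩ := hl.exists_cycle (i := i) (by omega) (hv ▸ huv) (hv' ▸ hwv)
  -- The cycle has at most `κ + 1` vertices and so misses part of `X`; by connectivity it can be
  -- opened into a path longer than `l`.
  by_cases hlX : l.toFinset = X
  · have := l.toFinset_card_le
    rw [hlX] at this
    omega
  · obtain ⟨a, ha, b, hb, hbl, hab⟩ := hX.exists_adj (A := l.toFinset)
      (fun v hv => hl.2.2 v (by simpa using hv)) (by simpa using hne) hlX
    obtain ⟨m, hm, hml⟩ := hc.exists_of_cycle hcyc (hperm.mem_iff.2 (by simpa using ha)) hb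
      (fun h => hbl (by simpa using hperm.mem_iff.1 h)) hab
    have := hout m hm
    rw [hml, hperm.length_eq] at this
    omega

/-- The **Erdős–Gallai theorem**: a graph without a path on `κ + 2` vertices has average degree
at most `κ`. -/
theorem PathFree.adjCount_le (h : G.PathFree (κ + 2) X) : G.adjCount X X ≤ κ * #X := by
  induction hn : #X using Nat.strong_induction_on generalizing X with
  | _ n ih =>
  subst hn
  by_cases hX : G.IsConn X
  · by_cases hcard : κ + 2 ≤ #X
    · obtain ⟨x, hx, hdeg⟩ := hX.exists_two_mul_card_filter_le h hcard
      have h1 := ih _ (card_lt_card (erase_ssubset hx)) (h.mono (erase_subset x X)) rfl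
      rw [adjCount_erase hx, filter_adj_erase, ← card_erase_add_one hx]
      linarith
    · have := G.adjCount_self_add_card_le (X := X)
      have h2 : #X * #X ≤ (κ + 1) * #X := Nat.mul_le_mul_right _ (by omega)
      linarith
  · rw [← sum_adjCount_comps, ← G.sum_card_comps (X := X), mul_sum]
    refine sum_le_sum fun C hC => ?_
    rw [mem_comps] at hC
    refine ih _ (card_lt_card (hC.1.ssubset_of_ne ?_)) (h.mono hC.1) rfl
    rintro rfl
    exact hX hC.2.1

end ErdosGallai

/-! ### Graphs at or near equality in the Erdős–Gallai bound -/

section Deficiency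

variable {V : Type*} [DecidableEq V] {G : SimpleGraph V} [DecidableRel G.Adj]
  {X Y Z A B C S T : Finset V} {k κ : ℕ}

/-- All degrees are at most `κ`, so a degree sum of `κ|X|` leaves no room for a missing edge. -/
lemma adj_of_mul_card_le_adjCount (hcard : #X = κ + 1) (h : κ * #X ≤ G.adjCount X X) :
    ∀ x ∈ X, ∀ y ∈ X, x ≠ y → G.Adj x y := by
  by_contra! hc
  obtain ⟨x, hx, y, hy, hxy, hnadj⟩ := hc
  refine h.not_gt ?_
  rw [adjCount_eq_sum, mul_comm, ← smul_eq_mul, ← sum_const]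
  have hsub : ∀ z ∈ X, X.filter (G.Adj z) ⊆ X.erase z := fun z _ v hv => by
    simp only [mem_filter, mem_erase] at hv ⊢
    exact ⟨hv.2.ne', hv.1⟩
  refine sum_lt_sum (fun z hz => ?_) ⟨x, hx, ?_⟩
  · refine (card_le_card (hsub z hz)).trans ?_
    rw [card_erase_of_mem hz]
    omega
  · have h1 : y ∈ X.erase x := mem_erase.2 ⟨hxy.symm, hy⟩
    refine (card_lt_card ((hsub x hx).ssubset_of_ne fun he => ?_)).trans_le
      (b := #(X.erase x)) ?_
    · rw [← he] at h1
      exact hnadj (mem_filter.1 h1).2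
    · rw [card_erase_of_mem hx]
      omega

lemma isPathList_toList_of_adj (h : ∀ x ∈ X, ∀ y ∈ X, x ≠ y → G.Adj x y) {l : List V}
    (hl : l.Nodup) (hlX : ∀ v ∈ l, v ∈ X) : G.IsPathList X l := by
  refine ⟨hl, List.Pairwise.isChain ?_, hlX⟩
  exact List.Pairwise.imp_of_mem (fun {a b} ha hb hab => h a (hlX a ha) b (hlX b hb) hab) hl

/-- A Hamiltonian path of the clique starting at `y`, preceded by `x`, would have `κ + 2` vertices.
-/
lemma PathFree.not_adj_clique (hX : G.PathFree (κ + 2) X) (hC : C ⊆ X) (hcard : #C = κ + 1)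
    (h : ∀ x ∈ C, ∀ y ∈ C, x ≠ y → G.Adj x y) {x y : V} (hx : x ∈ X) (hxC : x ∉ C)
    (hy : y ∈ C) : ¬ G.Adj x y := by
  intro hxy
  have hl : G.IsPathList C (y :: (C.erase y).toList) := by
    refine isPathList_toList_of_adj h (List.nodup_cons.2 ⟨by simp, nodup_toList _⟩) fun v hv => ?_
    rcases List.mem_cons.1 hv with rfl | hv
    exacts [hy, mem_of_mem_erase (mem_toList.1 hv)]
  have := hX _ ((hl.cons hxC (by simpa using hxy)).mono (insert_subset hx hC))
  simp only [List.length_cons, length_toList, card_erase_of_mem hy] at this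
  omega

lemma IsConn.exists_adj_of_isComp_erase (hX : G.IsConn X) {x : V} (hx : x ∈ X)
    (hC : G.IsComp (X.erase x) C) : ∃ y ∈ C, G.Adj x y := by
  obtain ⟨a, ha, b, hb, hbC, hab⟩ := hX.exists_adj (hC.1.trans (erase_subset _ _))
    hC.2.1.nonempty (fun h => (notMem_erase x X) (hC.1 (h ▸ hx)))
  rcases eq_or_ne b x with rfl | hbx
  · exact ⟨a, ha, hab.symm⟩
  · exact absurd (hC.2.2 a ha b (mem_erase.2 ⟨hbx, hb⟩) hab) hbC

/-- Equality in the Erdős–Gallai bound for a connected graph forces `κ + 1` vertices. -/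
lemma IsConn.card_eq_of_mul_card_le (hX : G.IsConn X) (hfree : G.PathFree (κ + 2) X)
    (h : κ * #X ≤ G.adjCount X X) : #X = κ + 1 := by
  induction hn : #X using Nat.strong_induction_on generalizing X with
  | _ n ih =>
  subst hn
  have hpos := hX.nonempty.card_pos
  rcases lt_trichotomy (#X) (κ + 1) with hlt | heq | hgt
  · have := G.adjCount_self_add_card_le (X := X)
    have h2 : #X * #X ≤ κ * #X := Nat.mul_le_mul_right _ (by omega)
    omega
  · exact heq
  · exfalso
    obtain ⟨x, hx, hdeg⟩ := hX.exists_two_mul_card_filter_le hfree hgt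
    have hfree' := hfree.mono (erase_subset x X)
    obtain ⟨y, hy⟩ : (X.erase x).Nonempty := by
      rw [← card_pos, card_erase_of_mem hx]
      omega
    obtain ⟨C, hC, hyC⟩ := exists_isComp_mem (G := G) hy
    -- Deleting `x` lowers `adjCount` by at most `κ`, so equality persists for `X.erase x` and hence
    -- for each of its components. By induction `C` is then a `K_{κ+1}`, to which `x` cannot be
    -- attached.
    have hCeq : κ * #C ≤ G.adjCount C C := by
      by_contra! hlt
      have h1 : G.adjCount (X.erase x) (X.erase x) < κ * #(X.erase x) := by
        rw [← sum_adjCount_comps, ← G.sum_card_comps (X := X.erase x), mul_sum]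
        refine sum_lt_sum (fun B hB => ?_) ⟨C, mem_comps.2 hC, hlt⟩
        exact (hfree'.mono (mem_comps.1 hB).1).adjCount_le
      rw [adjCount_erase hx, filter_adj_erase, ← card_erase_add_one hx] at h
      linarith
    have hCX := hC.1.trans (erase_subset x X)
    have hCcard := ih _ (card_lt_card (hC.1.trans_ssubset (erase_ssubset hx))) hC.2.1
      (hfree.mono hCX) hCeq rfl
    obtain ⟨z, hz, hxz⟩ := hX.exists_adj_of_isComp_erase hx hC
    exact hfree.not_adj_clique hCX hCcard (adj_of_mul_card_le_adjCount hCcard hCeq) hx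
      (fun h => notMem_erase x X (hC.1 h)) hz hxz

/-- For odd `κ`, the deficiency of a connected graph other than `K_{κ+1}` grows linearly. -/
lemma IsConn.card_le_of_odd (hκ : Odd κ) (hX : G.IsConn X) (hfree : G.PathFree (κ + 2) X)
    (h : G.adjCount X X < κ * #X) :
    #X + (κ + 2) * G.adjCount X X ≤ (κ + 2) * (κ * #X) := by
  induction hn : #X using Nat.strong_induction_on generalizing X with
  | _ n ih =>
  subst hn
  by_cases hcard : κ + 2 ≤ #X
  · obtain ⟨x, hx, hdeg⟩ := hX.exists_two_mul_card_filter_le hfree hcard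
    have key : #(X.erase x) + (κ + 2) * G.adjCount (X.erase x) (X.erase x) ≤
        (κ + 2) * (κ * #(X.erase x)) := by
      rw [← sum_adjCount_comps, ← G.sum_card_comps (X := X.erase x), mul_sum, mul_sum, mul_sum,
        ← sum_add_distrib]
      refine sum_le_sum fun C hC => ?_
      rw [mem_comps] at hC
      have hCX := hC.1.trans (erase_subset x X)
      refine ih _ (card_lt_card (hC.1.trans_ssubset (erase_ssubset hx))) hC.2.1
        (hfree.mono hCX) ?_ rfl
      by_contra! hCeq
      have hCcard := hC.2.1.card_eq_of_mul_card_le (hfree.mono hCX) hCeq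
      obtain ⟨z, hz, hxz⟩ := hX.exists_adj_of_isComp_erase hx hC
      exact hfree.not_adj_clique hCX hCcard (adj_of_mul_card_le_adjCount hCcard hCeq) hx
        (fun h => notMem_erase x X (hC.1 h)) hz hxz
    -- Parity gives `x` itself a deficiency of at least 1; the components of the rest are not tight,
    -- since `x` is attached to each.
    have hdeg' : 2 * #(X.filter (G.Adj x)) + 1 ≤ κ := by
      obtain ⟨m, rfl⟩ := hκ
      omega
    rw [adjCount_erase hx, filter_adj_erase, ← card_erase_add_one hx]
    nlinarith
  · have : (κ + 2) * (G.adjCount X X + 1) ≤ (κ + 2) * (κ * #X) := Nat.mul_le_mul_left _ h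
    linarith

/-! ### Connected graphs with a vertex set separating many components -/

lemma IsPathList.cons_of_adj {x : V} {l : List V} (hl : G.IsPathList X l) (hx : x ∉ X)
    {u : V} (hu : u ∈ l.head?) (h : G.Adj x u) : G.IsPathList (insert x X) (x :: l) :=
  hl.cons hx fun y hy => by
    rw [Option.mem_def] at hu hy
    rw [hu, Option.some.injEq] at hy
    exact hy ▸ h

lemma IsConn.eq_singleton_of_length_le_one (hX : G.IsConn X) {u : V} (hu : u ∈ X)
    (hp : ∀ l, G.IsPathList X l → u ∈ l.head? → l.length ≤ 1) : X = {u} := by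
  by_contra hne
  obtain ⟨a, ha, b, hb, hba, hab⟩ := hX.exists_adj (A := {u}) (by simpa using hu) (by simp)
    (Ne.symm hne)
  obtain rfl := mem_singleton.1 ha
  have hl : G.IsPathList X [a, b] := by
    refine ⟨by simpa using hab.ne, by simpa using hab, by simp [hu, hb]⟩
  have := hp _ hl (by simp)
  simp at this

/-- Delete `u`: each remaining component contains a neighbour of `u`, and paths starting there are
shorter by one vertex. The deletion itself costs at most `2(|X| - 1)`. -/
lemma IsConn.adjCount_le_of_length_le {p : ℕ} (hX : G.IsConn X) {u : V} (hu : u ∈ X)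
    (hp : ∀ l, G.IsPathList X l → u ∈ l.head? → l.length ≤ p + 1) :
    G.adjCount X X + 2 * p ≤ 2 * p * #X := by
  induction p generalizing X u with
  | zero =>
    rw [hX.eq_singleton_of_length_le_one hu hp, adjCount_singleton_self]
    simp
  | succ p ih =>
    have key : G.adjCount (X.erase u) (X.erase u) ≤ 2 * p * #(X.erase u) := by
      rw [← sum_adjCount_comps, ← G.sum_card_comps (X := X.erase u), mul_sum]
      refine sum_le_sum fun C hC => ?_
      rw [mem_comps] at hC
      obtain ⟨y, hy, huy⟩ := hX.exists_adj_of_isComp_erase hu hC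
      have huC : u ∉ C := fun h => notMem_erase u X (hC.1 h)
      refine (Nat.le_add_right _ _).trans (ih hC.2.1 hy fun l hl hly => ?_)
      have := hp (u :: l) ((hl.cons_of_adj huC hly huy).mono
        (insert_subset hu (hC.1.trans (erase_subset _ _)))) (by simp)
      simpa using this
    have h2 := card_filter_le (X.erase u) (G.Adj u)
    rw [adjCount_erase hu, ← card_erase_add_one hu]
    linarith

/-- A large connected graph without long paths has a small vertex set whose removal leaves many
components. -/
lemma exists_many_comps_sdiff (h Q : ℕ) : ∃ M : ℕ, ∀ {V : Type*} [DecidableEq V]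
    {G : SimpleGraph V} [DecidableRel G.Adj]
    {X : Finset V} {u : V}, G.IsConn X → u ∈ X →
    (∀ l, G.IsPathList X l → u ∈ l.head? → l.length ≤ h) → M ≤ #X →
    ∃ S ⊆ X, #S ≤ h ∧ Q ≤ #(G.comps (X \ S)) := by
  induction h with
  | zero =>
    refine ⟨0, fun {V _ G _ X u} hX hu hl _ => ?_⟩
    have := hl [u] (.singleton hu) (by simp)
    simp at this
  | succ h ih =>
    obtain ⟨M, hM⟩ := ih
    refine ⟨Q * M + 2, fun {V _ G _ X u} hX hu hl hcard => ?_⟩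
    by_cases hQ : Q ≤ #(G.comps (X.erase u))
    · refine ⟨{u}, by simpa using hu, by simp, ?_⟩
      rwa [sdiff_singleton_eq_erase]
    push Not at hQ
    -- Fewer than `Q` components share more than `Q * M` vertices. In the large component `T`, paths
    -- from a neighbour of `u` are shorter by one, so the induction applies.
    obtain ⟨T, hT, hTcard⟩ : ∃ T ∈ G.comps (X.erase u), M ≤ #T := by
      classical
      by_contra! hc
      have h1 : #(X.erase u) ≤ #(G.comps (X.erase u)) * M := by
        rw [← G.sum_card_comps (X := X.erase u), ← smul_eq_mul]
        exact sum_le_card_nsmul _ _ _ fun C hC => (hc C hC).le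
      have h2 : #(G.comps (X.erase u)) * M ≤ Q * M := Nat.mul_le_mul_right _ hQ.le
      have h3 := card_erase_of_mem hu
      omega
    rw [mem_comps] at hT
    obtain ⟨y, hy, huy⟩ := hX.exists_adj_of_isComp_erase hu hT
    have huT : u ∉ T := fun h => notMem_erase u X (hT.1 h)
    have hTX := hT.1.trans (erase_subset u X)
    obtain ⟨S, hST, hS, hQS⟩ := hM hT.2.1 hy (fun l hll hly => by
      have := hl (u :: l) ((hll.cons_of_adj huT hly huy).mono (insert_subset hu hTX)) (by simp)
      simpa using this) hTcard
    refine ⟨insert u S, insert_subset hu (hST.trans hTX),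
      (card_insert_le _ _).trans (by omega), hQS.trans (card_le_card fun C hC => ?_)⟩
    rw [mem_comps] at hC ⊢
    refine ⟨fun v hv => ?_, hC.2.1, fun a ha b hb hab => ?_⟩
    · have := mem_sdiff.1 (hC.1 hv)
      simp only [mem_sdiff, mem_insert, not_or]
      exact ⟨hTX this.1, fun h => huT (h ▸ this.1), this.2⟩
    · simp only [mem_sdiff, mem_insert, not_or] at hb
      refine hC.2.2 a ha b (mem_sdiff.2 ⟨?_, hb.2.2⟩) hab
      exact hT.2.2 a (mem_sdiff.1 (hC.1 ha)).1 b (mem_erase.2 ⟨hb.2.1, hb.1⟩) hab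

end Deficiency

/-! ### Threaded paths and graphs containing a large complete bipartite graph -/

section Stability

variable {V : Type*} [DecidableEq V] {G : SimpleGraph V} [DecidableRel G.Adj]
  {X Y Z A B C S T : Finset V} {k κ : ℕ}

lemma IsConn.exists_isPathList (hX : G.IsConn X) {x y : V} (hx : x ∈ X) (hy : y ∈ X) :
    ∃ l, G.IsPathList X l ∧ x ∈ l.head? ∧ y ∈ l.getLast? := by
  classical
  let R := X.filter fun y => ∃ l, G.IsPathList X l ∧ x ∈ l.head? ∧ y ∈ l.getLast?
  suffices R = X by
    rw [← this] at hy
    exact (mem_filter.1 hy).2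
  refine hX.2 R (filter_subset _ _)
    ⟨x, mem_filter.2 ⟨hx, [x], .singleton hx, by simp, by simp⟩⟩ fun a ha b hb hab => ?_
  obtain ⟨-, l, hl, hxl, hal⟩ := mem_filter.1 ha
  refine mem_filter.2 ⟨hb, ?_⟩
  by_cases hbl : b ∈ l
  · obtain ⟨l₁, l₂, rfl⟩ := List.append_of_mem hbl
    refine ⟨l₁ ++ [b], ⟨?_, ?_, fun v hv => hl.2.2 v ?_⟩, ?_, by simp⟩
    · exact hl.1.sublist (by simp)
    · have := hl.2.1
      exact (List.isChain_split.1 this).1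
    · simp only [List.mem_append, List.mem_cons] at hv ⊢
      tauto
    · cases l₁ <;> simp_all
  · refine ⟨l ++ [b], ⟨?_, ?_, ?_⟩, ?_, by simp⟩
    · rw [List.nodup_append']
      exact ⟨hl.1, by simp, by simpa using hbl⟩
    · rw [List.isChain_append]
      refine ⟨hl.2.1, by simp, fun c hc d hd => ?_⟩
      simp_all
    · intro v hv
      rcases List.mem_append.1 hv with hv | hv
      · exact hl.2.2 v hv
      · exact List.mem_singleton.1 hv ▸ hb
    · cases l <;> simp_all

/-- A path running through all vertices of `ss`, consecutive ones being linked inside distinct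
members of `F`, and ending with a path inside one further member of `F`. -/
lemma exists_linked_path {p : ℕ} (ss : List V) (hne : ss ≠ []) (hnd : ss.Nodup)
    (F : Finset (Finset V)) (hF : (F : Set (Finset V)).PairwiseDisjoint id)
    (hcard : ss.length ≤ #F) (hdisj : ∀ T ∈ F, ∀ s ∈ ss, s ∉ T)
    (hmid : ∀ T ∈ F, ∀ s ∈ ss, ∀ s' ∈ ss, ∃ l, G.IsPathList T l ∧
      (∃ u ∈ l.head?, G.Adj s u) ∧ ∃ w ∈ l.getLast?, G.Adj w s')
    (hend : ∀ T ∈ F, ∀ s ∈ ss, ∃ l, G.IsPathList T l ∧ (∃ u ∈ l.head?, G.Adj s u) ∧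
      p ≤ l.length) :
    ∃ l, G.IsPathList (ss.toFinset ∪ F.biUnion id) l ∧ l.head? = ss.head? ∧
      2 * ss.length + p ≤ l.length + 1 := by
  induction ss generalizing F with
  | nil => exact absurd rfl hne
  | cons s ss ih =>
    obtain ⟨T, hT⟩ : F.Nonempty := card_pos.1 (by simp at hcard; omega)
    have hsT := hdisj T hT s (by simp)
    -- Each of the `ss.length - 1` gaps is filled by at least one vertex and the end by at least
    -- `p`; this explains the `+ 1` in the length bound.
    rcases ss with _ | ⟨s', ss⟩
    · obtain ⟨l, hl, ⟨u, hu, hsu⟩, hlp⟩ := hend T hT s (by simp)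
      refine ⟨s :: l, (hl.cons_of_adj hsT hu hsu).mono ?_, by simp, by simp; omega⟩
      rw [insert_eq]
      exact union_subset_union (by simp) (subset_biUnion_of_mem id hT)
    · have hsub : ∀ T' ∈ F.erase T, T' ∈ F := fun T' h => mem_of_mem_erase h
      obtain ⟨l', hl', hhead, hlen⟩ := ih (by simp) (List.nodup_cons.1 hnd).2 (F.erase T)
        (hF.subset (by simp)) (by rw [card_erase_of_mem hT]; simp at hcard ⊢; omega)
        (fun T' h v hv => hdisj T' (hsub T' h) v (List.mem_cons_of_mem _ hv))
        (fun T' h v hv w hw => hmid T' (hsub T' h) v (List.mem_cons_of_mem _ hv) w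
          (List.mem_cons_of_mem _ hw))
        (fun T' h v hv => hend T' (hsub T' h) v (List.mem_cons_of_mem _ hv))
      obtain ⟨m, hm, ⟨u, hu, hsu⟩, w, hw, hws⟩ := hmid T hT s (by simp) s' (by simp)
      have hmne : m ≠ [] := by rintro rfl; simp at hu
      have h1 : G.IsPathList (T ∪ ((s' :: ss).toFinset ∪ (F.erase T).biUnion id)) (m ++ l') := by
        refine hm.append hl' ?_ fun x hx y hy => ?_
        · rw [Finset.disjoint_union_right]
          constructor
          · rw [Finset.disjoint_left]
            intro v hv hv'
            exact hdisj T hT v (List.mem_cons_of_mem _ (List.mem_toFinset.1 hv')) hv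
          · rw [Finset.disjoint_biUnion_right]
            exact fun T' h => hF hT (hsub T' h) (ne_of_mem_erase h).symm
        · rw [hhead] at hy
          obtain rfl : s' = y := by simpa using hy
          obtain rfl : w = x := Option.mem_unique hw hx
          exact hws
      have h2 : s ∉ T ∪ ((s' :: ss).toFinset ∪ (F.erase T).biUnion id) := by
        simp only [mem_union, not_or, mem_biUnion, not_exists, not_and, List.mem_toFinset]
        exact ⟨hsT, (List.nodup_cons.1 hnd).1, fun T' h => hdisj T' (hsub T' h) s (by simp)⟩
      refine ⟨s :: (m ++ l'), (h1.cons_of_adj h2 (u := u) ?_ hsu).mono ?_, by simp, ?_⟩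
      · rwa [List.head?_append_of_ne_nil _ hmne]
      · intro v hv
        simp only [mem_insert, mem_union, List.mem_toFinset, mem_biUnion, id,
          List.mem_cons] at hv ⊢
        rcases hv with hv | hv | (hv | hv) | ⟨T', hT', hv⟩
        · exact Or.inl (Or.inl hv)
        · exact Or.inr ⟨T, hT, hv⟩
        · exact Or.inl (Or.inr (Or.inl hv))
        · exact Or.inl (Or.inr (Or.inr hv))
        · exact Or.inr ⟨T', hsub T' hT', hv⟩
      · have := List.length_pos_iff.2 hmne
        simp only [List.length_cons, List.length_append] at hlen ⊢
        omega

/-- In a connected graph without a path on `2a + 2` vertices that contains `K_{a, a+2}`, the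
vertices outside the small class `A` are independent. -/
lemma IsConn.not_adj_of_complete (hX : G.IsConn X) (hfree : G.PathFree (2 * #A + 2) X)
    (hA : A.Nonempty) (hAX : A ⊆ X) (hBX : B ⊆ X) (hAB : Disjoint A B) (hB : #A + 2 ≤ #B)
    (hadj : ∀ x ∈ A, ∀ y ∈ B, G.Adj x y) :
    ∀ x ∈ X \ A, ∀ y ∈ X \ A, ¬ G.Adj x y := by
  -- Otherwise `y, x, v` extends to a path alternating between all of `A` and `#A` vertices of `B \
  -- {x, y}`, with `2 * #A + 2` vertices in total.
  have hno : ∀ x ∈ X \ A, ∀ y ∈ X \ A, G.Adj x y → ∀ v ∈ A, ¬ G.Adj v x := by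
    intro x hx y hy hxy v hv hvx
    rw [mem_sdiff] at hx hy
    have hss : ∀ u ∈ v :: (A.erase v).toList, u ∈ A := fun u hu => by
      rcases List.mem_cons.1 hu with rfl | hu
      exacts [hv, mem_of_mem_erase (mem_toList.1 hu)]
    have hB' : #B ≤ #(B \ {x, y}) + 2 := by
      have := le_card_sdiff {x, y} B
      have := card_le_two (a := x) (b := y)
      omega
    have hlen : (v :: (A.erase v).toList).length = #A := by
      rw [List.length_cons, length_toList, card_erase_add_one hv]
    obtain ⟨l, hl, hhead, hll⟩ : ∃ l, G.IsPathList ((v :: (A.erase v).toList).toFinset ∪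
        ((B \ {x, y}).image singleton).biUnion id) l ∧
        l.head? = (v :: (A.erase v).toList).head? ∧
        2 * (v :: (A.erase v).toList).length + 1 ≤ l.length + 1 := by
      refine exists_linked_path _ (by simp) (List.nodup_cons.2 ⟨by simp, nodup_toList _⟩) _
        ?_ ?_ ?_ ?_ ?_
      · intro S hS T hT hST
        obtain ⟨s, -, rfl⟩ := mem_image.1 (mem_coe.1 hS)
        obtain ⟨t, -, rfl⟩ := mem_image.1 (mem_coe.1 hT)
        simp only [Function.onFun, id, disjoint_singleton]
        rintro rfl
        exact hST rfl
      · rw [hlen, card_image_of_injective _ singleton_injective]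
        omega
      · intro T hT u hu huT
        obtain ⟨w, hw, rfl⟩ := mem_image.1 hT
        rw [mem_singleton.1 huT] at hu
        exact Finset.disjoint_left.1 hAB (hss w hu) (mem_sdiff.1 hw).1
      · intro T hT s hs s' hs'
        obtain ⟨w, hw, rfl⟩ := mem_image.1 hT
        exact ⟨[w], .singleton (by simp), ⟨w, by simp, hadj s (hss s hs) w (mem_sdiff.1 hw).1⟩, w,
          by simp, (hadj s' (hss s' hs') w (mem_sdiff.1 hw).1).symm⟩
      · intro T hT s hs
        obtain ⟨w, hw, rfl⟩ := mem_image.1 hT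
        exact ⟨[w], .singleton (by simp), ⟨w, by simp, hadj s (hss s hs) w (mem_sdiff.1 hw).1⟩,
          by simp⟩
    have h1 : G.IsPathList {x, y} [y, x] :=
      ⟨by simpa using hxy.ne', by simpa using hxy.symm, by simp⟩
    have h2 := h1.append hl ?_ ?_
    · have := hfree _ (h2.mono ?_)
      · simp only [List.length_append, List.length_cons, List.length_nil] at this hlen hll
        omega
      · refine union_subset (by simp [insert_subset_iff, hx.1, hy.1]) (union_subset ?_ ?_)
        · intro u hu
          exact hAX (hss u (List.mem_toFinset.1 hu))
        · intro u hu
          simp only [mem_biUnion, mem_image, mem_sdiff, id] at hu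
          obtain ⟨_, ⟨w, hw, rfl⟩, hu⟩ := hu
          exact hBX (mem_singleton.1 hu ▸ hw.1)
    · rw [Finset.disjoint_left]
      intro u hu hu'
      rcases mem_union.1 hu' with hu' | hu'
      · have := hss u (List.mem_toFinset.1 hu')
        rcases mem_insert.1 hu with rfl | hu
        · exact hx.2 this
        · exact hy.2 (mem_singleton.1 hu ▸ this)
      · simp only [mem_biUnion, mem_image, mem_sdiff, id] at hu'
        obtain ⟨_, ⟨w, hw, rfl⟩, hu'⟩ := hu'
        rw [mem_singleton.1 hu'] at hu
        exact hw.2 hu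
    · rw [hhead]
      simpa using hvx.symm
  -- Consequently `A` together with its neighbours is closed under adjacency, so it is all of `X`,
  -- and `hno` then rules out every edge outside `A`.
  have hW : A ∪ X.filter (fun x => x ∉ A ∧ ∃ v ∈ A, G.Adj v x) = X := by
    refine hX.2 _ (union_subset hAX (filter_subset _ _)) (hA.mono subset_union_left)
      fun a ha b hb hab => ?_
    by_cases hbA : b ∈ A
    · exact mem_union_left _ hbA
    rw [mem_union, mem_filter] at ha ⊢
    rcases ha with ha | ⟨haX, haA, v, hv, hva⟩
    · exact Or.inr ⟨hb, hbA, a, ha, hab⟩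
    · exact absurd hva (hno a (mem_sdiff.2 ⟨haX, haA⟩) b (mem_sdiff.2 ⟨hb, hbA⟩) hab v hv)
  intro x hx y hy hxy
  have hxX := (mem_sdiff.1 hx).1
  rw [← hW, mem_union, mem_filter] at hxX
  rcases hxX with h | ⟨-, -, v, hv, hvx⟩
  · exact (mem_sdiff.1 hx).2 h
  · exact hno x hx y hy hxy v hv hvx

/-- All edges meet `A`: at most `#A * (#A - 1)` ordered pairs lie inside it, and each outside vertex
not joined to all of `A` loses at least one edge. -/
lemma adjCount_le_of_not_adj (hAX : A ⊆ X) (h : ∀ x ∈ X \ A, ∀ y ∈ X \ A, ¬ G.Adj x y) :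
    G.adjCount X X + #A * (#A + 1) + 2 * #X ≤ 2 * #A * #X + 2 * #A +
      2 * #((X \ A).filter fun x => ∀ v ∈ A, G.Adj v x) := by
  have h1 : G.adjCount X X = G.adjCount A A + 2 * G.adjCount A (X \ A) := by
    have := G.adjCount_union_self (disjoint_sdiff (s := A) (t := X))
    rwa [union_sdiff_of_subset hAX, adjCount_eq_zero h] at this
  have h2 := G.adjCount_self_add_card_le (X := A)
  have h3 : G.adjCount A (X \ A) + #((X \ A).filter fun x => ¬ ∀ v ∈ A, G.Adj v x) ≤
      #A * #(X \ A) := by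
    rw [adjCount_comm, adjCount_eq_sum, card_filter, ← sum_add_distrib, mul_comm, ← smul_eq_mul]
    refine sum_le_card_nsmul _ _ _ fun x hx => ?_
    split_ifs with hc
    · exact card_filter_le _ _
    · push Not at hc
      obtain ⟨v, hv, hvx⟩ := hc
      exact Nat.succ_le_of_lt (card_lt_card (filter_ssubset.2 ⟨v, hv, fun h => hvx h.symm⟩))
  have h4 := card_filter_add_card_filter_not (s := X \ A) fun x => ∀ v ∈ A, G.Adj v x
  have h5 := card_sdiff_add_card_eq_card hAX
  nlinarith

end Stability

/-! ### Structure of large connected graphs of bounded deficiency -/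

section Stability

variable {V : Type*} [DecidableEq V] {G : SimpleGraph V} [DecidableRel G.Adj]
  {X Y Z A B C S T : Finset V} {a D h R : ℕ}

/-- Only few components of `X \ S` are incident with fewer edges than they should be. -/
lemma card_filter_comps_le (hfree : G.PathFree (2 * a + 2) X)
    (hD : 2 * a * #X ≤ G.adjCount X X + D) (hS : S ⊆ X) :
    #((G.comps (X \ S)).filter fun T => G.adjCount T T + 2 * G.adjCount T S < 2 * a * #T) ≤ D := by
  set F := (G.comps (X \ S)).filter fun T => G.adjCount T T + 2 * G.adjCount T S < 2 * a * #T
  have hFc : ∀ T ∈ F, G.IsComp (X \ S) T := fun T hT => mem_comps.1 (mem_filter.1 hT).1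
  have hFd : (F : Set (Finset V)).PairwiseDisjoint id :=
    comps_pairwiseDisjoint.subset fun T hT => mem_comps.2 (hFc T hT)
  set U := F.biUnion id with hU
  have hUX : U ⊆ X \ S := biUnion_subset.2 fun T hT => (hFc T hT).1
  have hTU : ∀ T ∈ F, T ⊆ U := fun T hT => subset_biUnion_of_mem id hT
  have hcl : ∀ T ∈ F, ∀ x ∈ T, ∀ z ∈ X, G.Adj x z → z ∈ T ∨ z ∈ S := by
    intro T hT x hx z hz hxz
    by_cases hzS : z ∈ S
    · exact Or.inr hzS
    · exact Or.inl ((hFc T hT).2.2 x hx z (mem_sdiff.2 ⟨hz, hzS⟩) hxz)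
  have h1 : G.adjCount U U = ∑ T ∈ F, G.adjCount T T := by
    conv_lhs => rw [hU, adjCount_biUnion_left hFd, ← hU]
    refine sum_congr rfl fun T hT => adjCount_eq_of_closed (hTU T hT) fun x hx z hz hxz => ?_
    have := mem_sdiff.1 (hUX hz)
    exact (hcl T hT x hx z this.1 hxz).resolve_right this.2
  have h2 : G.adjCount U (X \ U) = ∑ T ∈ F, G.adjCount T S := by
    conv_lhs => rw [hU, adjCount_biUnion_left hFd, ← hU]
    refine sum_congr rfl fun T hT => adjCount_eq_of_closed ?_ fun x hx z hz hxz => ?_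
    · exact fun s hs => mem_sdiff.2 ⟨hS hs, fun h => (mem_sdiff.1 (hUX h)).2 hs⟩
    · have := mem_sdiff.1 hz
      exact (hcl T hT x hx z this.1 hxz).resolve_left fun h => this.2 (hTU T hT h)
  have hUX' := hUX.trans sdiff_subset
  have h3 := G.adjCount_union_self (disjoint_sdiff (s := U) (t := X))
  rw [union_sdiff_of_subset hUX', h1, h2] at h3
  -- Erdős–Gallai on `X \ U` shows that the light components alone contribute at least `#F` to the
  -- deficiency.
  have h4 := (hfree.mono (sdiff_subset (s := X) (t := U))).adjCount_le
  have h5 : ∑ T ∈ F, G.adjCount T T + 2 * ∑ T ∈ F, G.adjCount T S + #F ≤ 2 * a * #U := by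
    rw [hU, card_biUnion fun A hA B hB h => hFd hA hB h, card_eq_sum_ones, mul_sum, mul_sum,
      ← sum_add_distrib, ← sum_add_distrib]
    exact sum_le_sum fun T hT => (mem_filter.1 hT).2
  have h6 := card_sdiff_add_card_eq_card hUX'
  nlinarith

/-- A path entering a component that is incident with many edges. -/
lemma IsConn.exists_long_path (hT : G.IsConn T) {k : ℕ} (hfree : G.PathFree k T)
    (hcount : 2 * a * #T ≤ G.adjCount T T + 2 * (#T * #A)) {s u : V} (hu : u ∈ T)
    (hsu : G.Adj s u) :
    ∃ l, G.IsPathList T l ∧ (∃ u ∈ l.head?, G.Adj s u) ∧ a + 1 ≤ #A + l.length ∧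
      (¬ (#T = 1 ∧ #A = a) → a + 2 ≤ #A + l.length) := by
  obtain ⟨l, hl, hul, hmax⟩ := hfree.exists_longest (p := fun l => u ∈ l.head?)
    ⟨[u], .singleton hu, by simp⟩
  obtain ⟨p, hp⟩ : ∃ p, l.length = p + 1 := by
    cases l
    · simp at hul
    · exact ⟨_, rfl⟩
  have h1 := hT.adjCount_le_of_length_le hu (p := p) fun m hm hum => hp ▸ hmax m hm hum
  have hpos := hT.nonempty.card_pos
  -- If `a = p + #A`, this forces `p = 0`, so no path from `u` leaves `u` and `T` is a single
  -- vertex.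
  have h2 : a * #T + p ≤ (p + #A) * #T := by nlinarith
  have h3 : a ≤ p + #A := by
    by_contra! hlt
    have : (p + #A + 1) * #T ≤ a * #T := Nat.mul_le_mul_right _ hlt
    nlinarith
  refine ⟨l, hl, ⟨u, hul, hsu⟩, by omega, fun hne => ?_⟩
  by_contra! hlt
  have h4 : a = p + #A := by omega
  rw [← h4] at h2
  obtain rfl : p = 0 := by omega
  refine hne ⟨?_, by omega⟩
  rw [hT.eq_singleton_of_length_le_one hu fun m hm hum => (hmax m hm hum).trans hp.le, card_singleton]

/-- Many components with the same neighbourhood `A` outside, each incident with many edges,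
are single vertices, and `A` has exactly `a` elements. -/
lemma card_eq_of_common_neighborhood (hfree : G.PathFree (2 * a + 2) X) (hAX : A ⊆ X)
    (hA : A.Nonempty) {F : Finset (Finset V)} (hF : (F : Set (Finset V)).PairwiseDisjoint id)
    (hcard : #A + 1 ≤ #F) (hFX : ∀ T ∈ F, T ⊆ X \ A) (hconn : ∀ T ∈ F, G.IsConn T)
    (hadj : ∀ T ∈ F, ∀ s ∈ A, ∃ x ∈ T, G.Adj s x)
    (hcount : ∀ T ∈ F, 2 * a * #T ≤ G.adjCount T T + 2 * (#T * #A)) :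
    ∀ T ∈ F, #T = 1 ∧ #A = a := by
  have hpath : ∀ T ∈ F, ∀ s ∈ A, ∃ l, G.IsPathList T l ∧ (∃ u ∈ l.head?, G.Adj s u) ∧
      a + 1 ≤ #A + l.length ∧ (¬ (#T = 1 ∧ #A = a) → a + 2 ≤ #A + l.length) := by
    intro T hT s hs
    obtain ⟨u, hu, hsu⟩ := hadj T hT s hs
    exact (hconn T hT).exists_long_path
      (hfree.mono ((hFX T hT).trans sdiff_subset)) (hcount T hT) hu hsu
  intro T₀ hT₀
  by_contra hne
  have hsub : ∀ T ∈ F.erase T₀, T ∈ F := fun T h => mem_of_mem_erase h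
  obtain ⟨l, hl, hhead, hlen⟩ : ∃ l,
      G.IsPathList (A.toList.toFinset ∪ (F.erase T₀).biUnion id) l ∧
      l.head? = A.toList.head? ∧ 2 * A.toList.length + (a + 1 - #A) ≤ l.length + 1 := by
    refine exists_linked_path _ (by simpa using hA.ne_empty) (nodup_toList _) _
      (hF.subset (by simp)) ?_ ?_ ?_ ?_
    · rw [length_toList, card_erase_of_mem hT₀]
      omega
    · intro T hT s hs hsT
      exact (mem_sdiff.1 (hFX T (hsub T hT) hsT)).2 (mem_toList.1 hs)
    · intro T hT s hs s' hs'
      rw [mem_toList] at hs hs'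
      obtain ⟨u, hu, hsu⟩ := hadj T (hsub T hT) s hs
      obtain ⟨w, hw, hsw⟩ := hadj T (hsub T hT) s' hs'
      obtain ⟨l, hl, hul, hwl⟩ := (hconn T (hsub T hT)).exists_isPathList hu hw
      exact ⟨l, hl, ⟨u, hul, hsu⟩, w, hwl, hsw.symm⟩
    · intro T hT s hs
      obtain ⟨l, hl, hul, hlen, -⟩ := hpath T (hsub T hT) s (mem_toList.1 hs)
      exact ⟨l, hl, hul, by omega⟩
  obtain ⟨s, hs⟩ : ∃ s, A.toList.head? = some s := by
    rw [← Option.ne_none_iff_exists', ne_eq, List.head?_eq_none_iff, toList_eq_nil]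
    exact hA.ne_empty
  obtain ⟨m, hm, ⟨u, hu, hsu⟩, -, hmlen⟩ := hpath T₀ hT₀ s
    (mem_toList.1 (List.mem_of_mem_head? hs))
  -- An exceptional `T₀` supplies `a + 2 - #A` vertices at the front; `A` and its links give `2 * #A
  -- - 1` and the far end `a + 1 - #A`, which makes `2a + 2`.
  have h1 := hm.reverse.append hl ?_ ?_
  · have h2 := hfree _ (h1.mono ?_)
    · simp only [List.length_append, List.length_reverse, length_toList] at h2 hlen
      have := hmlen hne
      omega
    · refine union_subset ((hFX T₀ hT₀).trans sdiff_subset) (union_subset (by simpa using hAX) ?_)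
      exact biUnion_subset.2 fun T hT => (hFX T (hsub T hT)).trans sdiff_subset
  · rw [Finset.disjoint_union_right, toList_toFinset, Finset.disjoint_biUnion_right]
    refine ⟨?_, fun T hT => hF hT₀ (hsub T hT) (ne_of_mem_erase hT).symm⟩
    exact Finset.disjoint_left.2 fun v hv => (mem_sdiff.1 (hFX T₀ hT₀ hv)).2
  · intro x hx y hy
    rw [List.getLast?_reverse] at hx
    rw [hhead] at hy
    obtain rfl := Option.mem_unique hu hx
    obtain rfl := Option.mem_unique hs hy
    exact hsu.symm

lemma IsConn.exists_complete_of_comps (hX : G.IsConn X) (hfree : G.PathFree (2 * a + 2) X)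
    (hD : 2 * a * #X ≤ G.adjCount X X + D) (hS : S ⊆ X) (hh : #S ≤ h) (hR : h + 2 ≤ R)
    (hQ : D + 2 ^ h * R ≤ #(G.comps (X \ S))) :
    ∃ A ⊆ X, ∃ B ⊆ X, Disjoint A B ∧ #A = a ∧ A.Nonempty ∧ R ≤ #B ∧
      ∀ x ∈ A, ∀ y ∈ B, G.Adj x y := by
  classical
  have h1 := card_filter_comps_le hfree hD hS
  have h2 := card_filter_add_card_filter_not (s := G.comps (X \ S))
    fun T => G.adjCount T T + 2 * G.adjCount T S < 2 * a * #T
  -- At most `D` components are light. Sorting the others by their neighbourhood in `S`, with at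
  -- most `2 ^ h` classes, leaves `R` with the same one.
  obtain ⟨A, hA, hfib⟩ := exists_le_card_fiber_of_mul_le_card_of_maps_to (n := R)
    (s := (G.comps (X \ S)).filter fun T => ¬ G.adjCount T T + 2 * G.adjCount T S < 2 * a * #T)
    (t := S.powerset) (f := fun T => S.filter fun s => ∃ x ∈ T, G.Adj s x)
    (fun T _ => mem_powerset.2 (filter_subset _ _)) ⟨∅, by simp⟩ (by
      rw [card_powerset]
      have : 2 ^ #S * R ≤ 2 ^ h * R :=
        Nat.mul_le_mul_right _ (Nat.pow_le_pow_right (by norm_num) hh)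
      omega)
  rw [mem_powerset] at hA
  obtain ⟨F, hF⟩ : ∃ F, F = ((G.comps (X \ S)).filter fun T =>
    ¬ G.adjCount T T + 2 * G.adjCount T S < 2 * a * #T).filter
      fun T => (S.filter fun s => ∃ x ∈ T, G.Adj s x) = A := ⟨_, rfl⟩
  rw [← hF] at hfib
  have hmem : ∀ T ∈ F, G.IsComp (X \ S) T ∧ 2 * a * #T ≤ G.adjCount T T + 2 * G.adjCount T S ∧
      ∀ s ∈ S, s ∈ A ↔ ∃ x ∈ T, G.Adj s x := by
    intro T hT
    rw [hF, mem_filter, mem_filter, mem_comps, not_lt] at hT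
    refine ⟨hT.1.1, hT.1.2, fun s hs => ?_⟩
    rw [← hT.2, mem_filter, and_iff_right hs]
  have hFd : (F : Set (Finset V)).PairwiseDisjoint id :=
    comps_pairwiseDisjoint.subset fun T hT => mem_comps.2 (hmem T hT).1
  have hAc : #A ≤ h := (card_le_card hA).trans hh
  obtain ⟨T, hT, T', hT', hTT'⟩ := one_lt_card.1 (show 1 < #F by omega)
  have hAne : A.Nonempty := by
    obtain ⟨hc, -, hn⟩ := hmem T hT
    have hdisj : Disjoint T T' := hFd hT hT' hTT'
    obtain ⟨x, hx, y, hy, hyT, hxy⟩ := hX.exists_adj (hc.1.trans sdiff_subset) hc.2.1.nonempty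
      fun he => by
        obtain ⟨z, hz⟩ := (hmem T' hT').1.2.1.nonempty
        refine Finset.disjoint_left.1 hdisj ?_ hz
        rw [he]
        exact (mem_sdiff.1 ((hmem T' hT').1.1 hz)).1
    by_cases hyS : y ∈ S
    · exact ⟨y, (hn y hyS).2 ⟨x, hx, hxy.symm⟩⟩
    · exact absurd (hc.2.2 x hx y (mem_sdiff.2 ⟨hy, hyS⟩) hxy) hyT
  have hone := card_eq_of_common_neighborhood hfree (hA.trans hS) hAne hFd (by omega)
    (fun T hT => (hmem T hT).1.1.trans (sdiff_subset_sdiff le_rfl hA))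
    (fun T hT => (hmem T hT).1.2.1)
    (fun T hT s hs => ((hmem T hT).2.2 s (hA hs)).1 hs)
    (fun T hT => by
      have h3 : G.adjCount T S = G.adjCount T A := adjCount_eq_of_closed hA
        fun x hx z hz hxz => ((hmem T hT).2.2 z hz).2 ⟨x, hx, hxz.symm⟩
      have h4 := G.adjCount_le_mul (X := T) (Y := A)
      have h5 := (hmem T hT).2.1
      omega)
  refine ⟨A, hA.trans hS, F.biUnion id, biUnion_subset.2 fun T hT =>
    (hmem T hT).1.1.trans sdiff_subset, ?_, (hone T hT).2, hAne, ?_, ?_⟩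
  · rw [Finset.disjoint_biUnion_right]
    intro T hT
    exact Finset.disjoint_left.2 fun s hs hsT =>
      (mem_sdiff.1 ((hmem T hT).1.1 hsT)).2 (hA hs)
  · rw [card_biUnion fun A hA B hB h => hFd hA hB h,
      sum_congr rfl fun T hT => show #(id T) = 1 from (hone T hT).1]
    simpa using hfib
  · intro s hs x hx
    obtain ⟨T, hT, hxT⟩ := mem_biUnion.1 hx
    obtain ⟨y, hy, hsy⟩ := ((hmem T hT).2.2 s (hA hs)).1 hs
    rwa [card_le_one.1 (hone T hT).1.le x hxT y hy]

/-- A large connected graph of bounded deficiency without a path on `2a + 2` vertices consists of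
an `a`-set `A` and an independent set, almost all of which is completely joined to `A`. -/
lemma exists_complete_of_deficiency_le (a D : ℕ) : ∃ M : ℕ, ∀ {V : Type*} [DecidableEq V]
    {G : SimpleGraph V} [DecidableRel G.Adj] {X : Finset V}, G.IsConn X →
    G.PathFree (2 * a + 2) X → 2 * a * #X ≤ G.adjCount X X + D → M ≤ #X →
    ∃ A ⊆ X, ∃ B ⊆ X \ A, #A = a ∧ (∀ x ∈ A, ∀ y ∈ B, G.Adj x y) ∧
      G.adjCount X X + a * (a + 1) + 2 * #X ≤ 2 * a * #X + 2 * a + 2 * #B := by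
  obtain ⟨M, hM⟩ := exists_many_comps_sdiff (2 * a + 1) (D + 2 ^ (2 * a + 1) * (2 * a + 3))
  refine ⟨M, fun {V _ G _ X} hX hfree hD hcard => ?_⟩
  obtain ⟨u, hu⟩ := hX.nonempty
  obtain ⟨S, hS, hh, hQ⟩ := hM hX hu (fun l hl _ => Nat.le_of_lt_succ (hfree l hl)) hcard
  obtain ⟨A, hAX, B, hBX, hAB, rfl, hA, hB, hadj⟩ :=
    hX.exists_complete_of_comps hfree hD hS hh le_rfl hQ
  have hind := hX.not_adj_of_complete hfree hA hAX hBX hAB (by omega) hadj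
  exact ⟨A, hAX, (X \ A).filter fun x => ∀ v ∈ A, G.Adj v x, filter_subset _ _, rfl, fun x hx y hy => (mem_filter.1 hy).2 x hx,
    adjCount_le_of_not_adj hAX hind⟩

end Stability

/-! ### From vertex sets to copies of the target graphs -/

section Containment

variable {V : Type*} [DecidableEq V] {G : SimpleGraph V} [DecidableRel G.Adj]
  {X Y Z A B C S T : Finset V} {a D h R κ : ℕ}

lemma Free.pathFree {k : ℕ} (h : (pathGraph k).Free G) (X : Finset V) : G.PathFree k X := by
  intro l hl
  by_contra! hk
  refine h ⟨⟨fun i => l[i.val], fun {i j} hij => ?_⟩, fun i j hij => ?_⟩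
  · have hc := List.isChain_iff_getElem.1 hl.2.1
    have hi := i.2
    have hj := j.2
    rw [pathGraph_adj] at hij
    rcases hij with hij | hij
    · have := hc i.val (by omega)
      simpa only [hij] using this
    · have := hc j.val (by omega)
      simpa only [hij] using this.symm
  · exact Fin.ext ((hl.1.getElem_inj_iff).1 hij)

lemma exists_injective_fin_mem {α : Type*} {F : Finset α} {s : ℕ} (h : s ≤ #F) :
    ∃ f : Fin s → α, Function.Injective f ∧ ∀ i, f i ∈ F :=
  ⟨fun i => F.equivFin.symm (Fin.castLE h i), fun i j hij => by
    simpa using F.equivFin.symm.injective (Subtype.ext hij), fun i => Subtype.prop _⟩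

lemma isContained_completeBipartiteGraph {a s : ℕ} (hA : a ≤ #A) (hB : s ≤ #B)
    (hAB : Disjoint A B) (h : ∀ x ∈ A, ∀ y ∈ B, G.Adj x y) :
    (completeBipartiteGraph (Fin a) (Fin s)).IsContained G := by
  obtain ⟨f, hf, hfA⟩ := exists_injective_fin_mem hA
  obtain ⟨g, hg, hgB⟩ := exists_injective_fin_mem hB
  refine ⟨⟨Sum.elim f g, fun {x y} hxy => ?_⟩, ?_⟩
  · rcases x with x | x <;> rcases y with y | y <;> simp at hxy
    · exact h _ (hfA x) _ (hgB y)
    · exact (h _ (hfA y) _ (hgB x)).symm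
  · exact hf.sumElim hg fun i j hij => Finset.disjoint_left.1 hAB (hfA i) (hij ▸ hgB j)

lemma isContained_disjointCopies {m s : ℕ} {F : Finset (Finset V)}
    (hF : (F : Set (Finset V)).PairwiseDisjoint id) (hs : s ≤ #F) (hm : ∀ C ∈ F, m ≤ #C)
    (hadj : ∀ C ∈ F, ∀ x ∈ C, ∀ y ∈ C, x ≠ y → G.Adj x y) :
    (disjointCopies s (completeGraph (Fin m))).IsContained G := by
  obtain ⟨f, hf, hfF⟩ := exists_injective_fin_mem hs
  choose g hg hgC using fun i => exists_injective_fin_mem (hm _ (hfF i))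
  refine ⟨⟨fun x => g x.1 x.2, fun {x y} hxy => ?_⟩, ?_⟩
  · obtain ⟨i, u⟩ := x
    obtain ⟨j, v⟩ := y
    obtain ⟨hij, huv⟩ := hxy
    obtain rfl : i = j := hij
    exact hadj _ (hfF i) _ (hgC i u) _ (hgC i v) fun he => huv (hg i he)
  · rintro ⟨i, u⟩ ⟨j, v⟩ he
    have he : g i u = g j v := he
    obtain rfl : i = j := by
      by_contra hij
      exact Finset.disjoint_left.1 (hF (hfF i) (hfF j) fun h => hij (hf h)) (hgC i u)
        (he ▸ hgC j v)
    rw [hg i he]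

lemma two_mul_card_edgeFinset_eq_adjCount [Fintype V] : 2 * #G.edgeFinset = G.adjCount univ univ := by
  rw [← sum_degrees_eq_twice_card_edges, adjCount_eq_sum]
  exact sum_congr rfl fun x _ => by rw [← card_neighborFinset_eq_degree, neighborFinset_eq_filter]

end Containment

/-! ### A lower bound for the extremal number of a path -/

section ExtremalNumber

/-- The disjoint union of complete graphs on `m i` vertices. -/
def unionOfComplete {ι : Type*} (m : ι → ℕ) : SimpleGraph (Σ i, Fin (m i)) where
  Adj x y := x.1 = y.1 ∧ x ≠ y
  symm := ⟨fun _ _ h => ⟨h.1.symm, h.2.symm⟩⟩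
  loopless := ⟨fun _ h => h.2 rfl⟩

instance {ι : Type*} [DecidableEq ι] (m : ι → ℕ) : DecidableRel (unionOfComplete m).Adj :=
  fun x y => inferInstanceAs (Decidable (x.1 = y.1 ∧ x ≠ y))

/-- A path cannot leave its block, and no block has enough vertices for it. -/
lemma pathGraph_free_unionOfComplete {ι : Type*} {m : ι → ℕ} {k : ℕ}
    (hm : ∀ i, m i < k + 1) : (pathGraph (k + 1)).Free (unionOfComplete m) := by
  rintro ⟨⟨f, hf⟩⟩
  have h1 : ∀ i (hi : i < k + 1), (f ⟨i, hi⟩).1 = (f 0).1 := by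
    intro i
    induction i with
    | zero => intro _; rfl
    | succ i ih =>
      intro hi
      have : (pathGraph (k + 1)).Adj ⟨i, by omega⟩ ⟨i + 1, hi⟩ := by simp [pathGraph_adj]
      exact (f.map_rel this).1.symm.trans (ih (by omega))
  have h2 : ∀ i, ∃ v : Fin (m (f 0).1), f i = ⟨(f 0).1, v⟩ := by
    intro i
    have := h1 i.1 i.2
    refine ⟨this ▸ (f i).2, ?_⟩
    rw [Sigma.ext_iff]
    exact ⟨this, by simp⟩
  choose g hg using h2
  have hinj : Function.Injective g := fun i j hij => hf (by
    rw [hg i, hg j, hij])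
  have := Fintype.card_le_of_injective g hinj
  simp only [Fintype.card_fin] at this
  have := hm (f 0).1
  omega

lemma adjCount_unionOfComplete {ι : Type*} [Fintype ι] [DecidableEq ι] (m : ι → ℕ) :
    (unionOfComplete m).adjCount univ univ = ∑ i, m i * (m i - 1) := by
  rw [adjCount_eq_sum, univ_sigma_univ.symm, sum_sigma]
  refine sum_congr rfl fun i _ => ?_
  have : ∀ v : Fin (m i), ((univ : Finset (Σ i, Fin (m i))).filter
      ((unionOfComplete m).Adj ⟨i, v⟩)) = (univ.erase v).map (Function.Embedding.sigmaMk i) := by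
    intro v
    ext ⟨j, w⟩
    rw [mem_filter, mem_map]
    simp only [mem_univ, true_and, mem_erase, and_true]
    constructor
    · rintro ⟨h1, h2⟩
      obtain rfl : i = j := h1
      exact ⟨w, fun h => h2 (h ▸ rfl), rfl⟩
    · rintro ⟨u, hu, he⟩
      rw [← he]
      exact ⟨rfl, fun h => hu (by simpa using h.symm)⟩
  simp only [univ_sigma_univ, this, card_map, card_erase_of_mem (mem_univ _), card_univ,
    Fintype.card_fin, sum_const, smul_eq_mul]

/-- Take `n / (κ + 1)` copies of `K_{κ+1}` and a clique on the `r` remaining vertices. Only the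
latter has a deficiency, namely `r(κ + 1 - r)`. -/
lemma mul_le_extremalNumber_pathGraph (κ n : ℕ) :
    κ * n ≤ 2 * extremalNumber n (pathGraph (κ + 2)) +
      n % (κ + 1) * (κ + 1 - n % (κ + 1)) := by
  set q := n / (κ + 1)
  set r := n % (κ + 1) with hr
  have hrlt : r < κ + 1 := Nat.mod_lt _ (by omega)
  let m : Option (Fin q) → ℕ := fun i => i.elim r fun _ => κ + 1
  have hn : (κ + 1) * q + r = n := Nat.div_add_mod n (κ + 1)
  have hcard : Fintype.card (Σ i, Fin (m i)) = n := by
    simp [m, Fintype.sum_option]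
    linarith
  have hfree := card_edgeFinset_le_extremalNumber (pathGraph_free_unionOfComplete (m := m)
    (k := κ + 1) fun i => by cases i <;> simp [m]; omega)
  have h := adjCount_unionOfComplete m
  rw [← two_mul_card_edgeFinset_eq_adjCount] at h
  rw [hcard] at hfree
  simp only [m, Fintype.sum_option, Option.elim_none, Option.elim_some, sum_const, card_univ,
    Fintype.card_fin, smul_eq_mul, Nat.add_sub_cancel] at h
  have h2 : r * (r - 1) + r * (κ + 1 - r) = κ * r := by
    rw [← Nat.mul_add, mul_comm κ]
    rcases Nat.eq_zero_or_pos r with h0 | h0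
    · rw [h0]; simp
    · congr 1; omega
  nlinarith

end ExtremalNumber

/-! ### Counting tight and non-tight components -/

section Main

variable {V : Type*} [DecidableEq V] {G : SimpleGraph V} [DecidableRel G.Adj]
  {X Y Z A B C S T : Finset V} {a c D h R M s κ : ℕ}

variable (G κ) in
/-- The components of the graph induced by `X` that attain the Erdős–Gallai bound. -/
noncomputable def tightComps (X : Finset V) : Finset (Finset V) :=
  (G.comps X).filter fun C => κ * #C ≤ G.adjCount C C

lemma isContained_disjointCopies_of_le_card_tightComps (hfree : G.PathFree (κ + 2) X)
    (hs : s ≤ #(G.tightComps κ X)) :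
    (disjointCopies s (completeGraph (Fin (κ + 1)))).IsContained G := by
  have hmem : ∀ C ∈ G.tightComps κ X, #C = κ + 1 ∧ κ * #C ≤ G.adjCount C C := fun C hC => by
    rw [tightComps, mem_filter, mem_comps] at hC
    exact ⟨hC.1.2.1.card_eq_of_mul_card_le (hfree.mono hC.1.1) hC.2, hC.2⟩
  exact isContained_disjointCopies
    (comps_pairwiseDisjoint.subset (coe_subset.2 (filter_subset _ _))) hs
    (fun C hC => (hmem C hC).1.ge)
    fun C hC => adj_of_mul_card_le_adjCount (hmem C hC).1 (hmem C hC).2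

/-- The total deficiency of any set of components is at most that of the whole graph. -/
lemma sum_mul_card_le_of_subset_comps (hfree : G.PathFree (κ + 2) X)
    (hD : κ * #X ≤ G.adjCount X X + D) {F : Finset (Finset V)} (hF : F ⊆ G.comps X) :
    ∑ C ∈ F, κ * #C ≤ ∑ C ∈ F, G.adjCount C C + D := by
  classical
  rw [← sum_adjCount_comps, ← G.sum_card_comps (X := X), mul_sum, ← sum_sdiff hF,
    ← sum_sdiff hF (f := fun C => G.adjCount C C)] at hD
  have : ∑ C ∈ G.comps X \ F, G.adjCount C C ≤ ∑ C ∈ G.comps X \ F, κ * #C :=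
    sum_le_sum fun C hC =>
      (hfree.mono (mem_comps.1 (mem_sdiff.1 hC).1).1).adjCount_le
  omega

/-- The hypothesis `hM` says that each member of `F` has deficiency at least `|C|/M`, and these add
up to at most `D`. -/
lemma sum_card_le_of_subset_comps (hfree : G.PathFree (κ + 2) X)
    (hD : κ * #X ≤ G.adjCount X X + D) {F : Finset (Finset V)} (hF : F ⊆ G.comps X)
    (hM : ∀ C ∈ F, #C + M * G.adjCount C C ≤ M * (κ * #C)) : ∑ C ∈ F, #C ≤ M * D := by
  have h1 := Nat.mul_le_mul_left M (sum_mul_card_le_of_subset_comps hfree hD hF)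
  have h2 := sum_le_sum hM
  rw [sum_add_distrib, ← mul_sum, ← mul_sum] at h2
  rw [mul_add] at h1
  omega

lemma card_eq_tightComps_add (hfree : G.PathFree (κ + 2) X) :
    #X = (κ + 1) * #(G.tightComps κ X) +
      ∑ C ∈ (G.comps X).filter (fun C => ¬ κ * #C ≤ G.adjCount C C), #C := by
  rw [← G.sum_card_comps (X := X), ← sum_filter_add_sum_filter_not _
    fun C => κ * #C ≤ G.adjCount C C, tightComps]
  congr 1
  rw [mul_comm, ← smul_eq_mul, ← sum_const]
  refine sum_congr rfl fun C hC => ?_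
  rw [mem_filter, mem_comps] at hC
  exact hC.1.2.1.card_eq_of_mul_card_le (hfree.mono hC.1.1) hC.2

/-- Non-tight components cover at most `(κ + 2) * D` vertices, hence at most half of `X`; the tight
ones cover the other half in blocks of `κ + 1`. -/
lemma le_card_tightComps_of_odd (hκ : Odd κ) (hfree : G.PathFree (κ + 2) X)
    (hD : κ * #X ≤ G.adjCount X X + D) (hX : 2 * ((κ + 2) * D) ≤ #X)
    (hs : 2 * (κ + 1) * s < #X + 2 * (κ + 1)) : s ≤ #(G.tightComps κ X) := by
  have h1 := card_eq_tightComps_add hfree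
  have h2 := sum_card_le_of_subset_comps (M := κ + 2) hfree hD (filter_subset
    (fun C => ¬ κ * #C ≤ G.adjCount C C) (G.comps X)) fun C hC => by
      rw [mem_filter, mem_comps, not_le] at hC
      exact hC.1.2.1.card_le_of_odd hκ (hfree.mono hC.1.1) hC.2
  by_contra! hlt
  have h3 : 2 * (κ + 1) * (#(G.tightComps κ X) + 1) ≤ 2 * (κ + 1) * s :=
    Nat.mul_le_mul_left _ hlt
  nlinarith

/-- For `κ = 2a` the graph contains `K_{a,s}` unless there are `s` tight components. -/
lemma exists_forall_isContained_of_even (a c : ℕ) (ha : 1 ≤ a) (hc : 1 ≤ c) :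
    ∃ N : ℕ, ∀ {V : Type*} [DecidableEq V] {G : SimpleGraph V} [DecidableRel G.Adj]
      {X : Finset V} {s : ℕ}, G.PathFree (2 * a + 2) X →
      2 * a * #X ≤ G.adjCount X X + (2 * c + a * (a + 1)) → N ≤ #X →
      16 * c * s < #X + 16 * c → 2 * (2 * a + 1) * s < #X + 2 * (2 * a + 1) →
      (completeBipartiteGraph (Fin a) (Fin s)).IsContained G ∨
        s ≤ #(G.tightComps (2 * a) X) := by
  obtain ⟨M, hM⟩ := exists_complete_of_deficiency_le a (2 * c + a * (a + 1))
  obtain ⟨D, hDdef⟩ : ∃ D, D = 2 * c + a * (a + 1) := ⟨_, rfl⟩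
  rw [← hDdef] at hM
  refine ⟨4 * (2 * (M * D) + 4 * c * (a + D) + 4 * c), fun {V _ G _ X s} hfree hD hN hs₁ hs₂ => ?_⟩
  rw [← hDdef] at hD
  rw [or_iff_not_imp_right]
  intro hlt
  rw [not_le] at hlt
  have h1 := card_eq_tightComps_add hfree
  set F := (G.comps X).filter fun C => ¬ 2 * a * #C ≤ G.adjCount C C with hF
  have hFmem : ∀ C ∈ F, G.IsComp X C ∧ G.adjCount C C < 2 * a * #C := fun C hC => by
    rwa [hF, mem_filter, mem_comps, not_le] at hC
  have hFsub : F ⊆ G.comps X := filter_subset _ _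
  rw [← sum_filter_add_sum_filter_not F fun C => #C < M] at h1
  have hsmall := sum_card_le_of_subset_comps (M := M) hfree hD
    ((filter_subset (fun C => #C < M) F).trans hFsub) fun C hC => by
      rw [mem_filter] at hC
      have := Nat.mul_le_mul_left M (Nat.succ_le_of_lt (hFmem C hC.1).2)
      rw [Nat.mul_succ] at this
      omega
  set 𝓑 := F.filter fun C => ¬ #C < M with h𝓑
  have hBsub : 𝓑 ⊆ G.comps X := (filter_subset _ _).trans hFsub
  have hbig : ∀ C ∈ 𝓑, ∃ A ⊆ C, ∃ B ⊆ C \ A, #A = a ∧ (∀ x ∈ A, ∀ y ∈ B, G.Adj x y) ∧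
      G.adjCount C C + a * (a + 1) + 2 * #C ≤ 2 * a * #C + 2 * a + 2 * #B := by
    intro C hC
    rw [h𝓑, mem_filter, not_lt] at hC
    have hCc := (hFmem C hC.1).1
    have := sum_mul_card_le_of_subset_comps hfree hD
      (singleton_subset_iff.2 (mem_comps.2 hCc))
    rw [sum_singleton, sum_singleton] at this
    exact hM hCc.2.1 (hfree.mono hCc.1) this hC.2
  -- Since `#B ≤ #C - a`, each large component has deficiency at least `a(a+1) ≥ 2`, out of a total
  -- of `2c + a(a+1)`.
  have hcount : #𝓑 ≤ c + 1 := by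
    have h2 := sum_mul_card_le_of_subset_comps hfree hD hBsub
    have h3 : ∑ C ∈ 𝓑, G.adjCount C C + #𝓑 * (a * (a + 1)) ≤ ∑ C ∈ 𝓑, 2 * a * #C := by
      rw [← smul_eq_mul, ← sum_const, ← sum_add_distrib]
      refine sum_le_sum fun C hC => ?_
      obtain ⟨A, hA, B, hB, hAc, -, hle⟩ := hbig C hC
      have := card_le_card hB
      have := card_sdiff_add_card_eq_card hA
      omega
    have h4 : 2 ≤ a * (a + 1) := by nlinarith
    by_contra! hc2
    have h5 : (c + 2) * (a * (a + 1)) ≤ #𝓑 * (a * (a + 1)) := Nat.mul_le_mul_right _ hc2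
    nlinarith
  -- If all were this small, the tight components would cover less than `|X|/2`, the large ones less
  -- than `|X|/8` plus a constant and the small ones a constant; the choice of `N` excludes this. In
  -- a component above the threshold, `hle` and the deficiency bound give `#B ≥ s`.
  by_cases hall : ∀ C ∈ 𝓑, #C ≤ s + a + D
  · exfalso
    have h2 : ∑ C ∈ 𝓑, #C ≤ 2 * c * (s + a + D) := by
      refine (sum_le_card_nsmul _ _ _ hall).trans ?_
      rw [smul_eq_mul]
      exact Nat.mul_le_mul_right _ (by omega)
    have h3 : 2 * (2 * a + 1) * (#(G.tightComps (2 * a) X) + 1) ≤ 2 * (2 * a + 1) * s :=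
      Nat.mul_le_mul_left _ hlt
    nlinarith
  · push Not at hall
    obtain ⟨C, hC, hCs⟩ := hall
    obtain ⟨A, hA, B, hB, hAc, hadj, hle⟩ := hbig C hC
    have h2 := sum_mul_card_le_of_subset_comps hfree hD
      (singleton_subset_iff.2 (hBsub hC))
    rw [sum_singleton, sum_singleton] at h2
    refine isContained_completeBipartiteGraph hAc.ge (by omega) ?_ hadj
    exact Finset.disjoint_left.2 fun x hx hxB => (mem_sdiff.1 (hB hxB)).2 hx

end Main

end SimpleGraph

/-- Two naturals with sum `2a + 1` have the largest product when they are `a` and `a + 1`. The sharp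
value matters: it equals the deficiency forced by one large component. -/
lemma mul_two_mul_add_one_sub_le (a r : ℕ) : r * (2 * a + 1 - r) ≤ a * (a + 1) := by
  rcases le_or_gt r (2 * a + 1) with h | h
  · obtain ⟨d, hd⟩ := Nat.exists_eq_add_of_le h
    rw [hd, Nat.add_sub_cancel_left]
    rcases le_or_gt r a with h1 | h1
    · obtain ⟨e, rfl⟩ := Nat.exists_eq_add_of_le h1
      obtain rfl : d = r + 2 * e + 1 := by omega
      nlinarith
    · obtain ⟨e, rfl⟩ := Nat.exists_eq_add_of_lt h1
      obtain rfl : a = d + e := by omega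
      nlinarith
  · rw [Nat.sub_eq_zero_of_le h.le]
    simp

theorem lemma2p4 (k c : ℕ) (hk : 2 ≤ k) (hc : 1 ≤ c) :
    ∃ N : ℕ, ∀ n : ℕ, N ≤ n →
      ∀ (V : Type*) [Fintype V] (G : SimpleGraph V) [DecidableRel G.Adj],
        Fintype.card V = n →
        (SimpleGraph.pathGraph k).Free G →
        (SimpleGraph.extremalNumber n (SimpleGraph.pathGraph k) : ℝ) - c ≤ G.edgeFinset.card →
        ∀ s : ℕ, s = ⌈min ((n : ℝ) / (16 * c)) ((n : ℝ) / (2 * k - 2))⌉₊ →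
          (completeBipartiteGraph (Fin (k / 2 - 1)) (Fin s)).IsContained G ∨
          (SimpleGraph.disjointCopies s (SimpleGraph.completeGraph (Fin (k - 1)))).IsContained G := by
  obtain ⟨κ, rfl⟩ := Nat.exists_eq_add_of_le' hk
  obtain ⟨N, hN⟩ : ∃ N : ℕ, ∀ {V : Type _} [DecidableEq V] {G : SimpleGraph V}
      [DecidableRel G.Adj] {X : Finset V} {s : ℕ}, G.PathFree (κ + 2) X →
      κ * #X ≤ G.adjCount X X + (2 * c + #X % (κ + 1) * (κ + 1 - #X % (κ + 1))) → N ≤ #X →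
      16 * c * s < #X + 16 * c → 2 * (κ + 1) * s < #X + 2 * (κ + 1) →
      (completeBipartiteGraph (Fin (κ / 2)) (Fin s)).IsContained G ∨
        s ≤ #(G.tightComps κ X) := by
    -- When `κ / 2 = 0` the bipartite graph is edgeless, and any `s` vertices suffice.
    rcases Nat.eq_zero_or_pos (κ / 2) with h0 | hpos
    · refine ⟨0, fun {V _ G _ X s} _ _ _ _ hs => Or.inl ?_⟩
      refine SimpleGraph.isContained_completeBipartiteGraph (A := ∅) (B := X) (by simp [h0]) ?_
        (by simp) (by simp)
      by_contra! hlt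
      nlinarith
    · rcases Nat.even_or_odd' κ with ⟨a, rfl | hodd⟩
      · rw [Nat.mul_div_cancel_left a two_pos] at hpos
        obtain ⟨N, hN⟩ := SimpleGraph.exists_forall_isContained_of_even a c hpos hc
        refine ⟨N, fun {V _ G _ X s} hfree hD hX hs₁ hs₂ => ?_⟩
        rw [Nat.mul_div_cancel_left a two_pos]
        refine hN hfree (hD.trans ?_) hX hs₁ hs₂
        have := mul_two_mul_add_one_sub_le a (#X % (2 * a + 1))
        omega
      · refine ⟨2 * ((κ + 2) * (2 * c + (κ + 1) * (κ + 1))),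
          fun {V _ G _ X s} hfree hD hX _ hs => Or.inr ?_⟩
        refine SimpleGraph.le_card_tightComps_of_odd ⟨a, hodd⟩ hfree (hD.trans ?_) hX hs
        have : #X % (κ + 1) * (κ + 1 - #X % (κ + 1)) ≤ (κ + 1) * (κ + 1) :=
          Nat.mul_le_mul (Nat.mod_lt _ (by omega)).le (Nat.sub_le _ _)
        omega
  refine ⟨N, fun n hn V _ G _ hV hG he s hs => ?_⟩
  classical
  have hX : #(univ : Finset V) = n := by rw [card_univ, hV]
  have hfree := hG.pathFree (univ : Finset V)
  have hc' : (0 : ℝ) < 16 * c := by positivity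
  have hk' : (0 : ℝ) < 2 * (κ + 1) := by positivity
  -- The ceiling enters only through `⌈x⌉ < x + 1`, which yields the integer inequalities `hs₁` and
  -- `hs₂`.
  have hceil : (s : ℝ) < min ((n : ℝ) / (16 * c)) ((n : ℝ) / (2 * ((κ + 2 : ℕ) : ℝ) - 2)) + 1 := by
    rw [hs]
    refine Nat.ceil_lt_add_one (le_min (by positivity) (div_nonneg (by positivity) ?_))
    push_cast
    linarith
  have he' : SimpleGraph.extremalNumber n (SimpleGraph.pathGraph (κ + 2)) ≤
      #G.edgeFinset + c := by
    have : (SimpleGraph.extremalNumber n (SimpleGraph.pathGraph (κ + 2)) : ℝ) ≤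
        #G.edgeFinset + c := by linarith
    exact_mod_cast this
  have hs₁ : 16 * c * s < n + 16 * c := by
    have h1 := hceil.trans_le (add_le_add_left (min_le_left _ _) 1)
    rw [← sub_lt_iff_lt_add, lt_div_iff₀ hc'] at h1
    have : (16 * c * s : ℝ) < n + 16 * c := by linarith
    exact_mod_cast this
  have hs₂ : 2 * (κ + 1) * s < n + 2 * (κ + 1) := by
    have h1 := hceil.trans_le (add_le_add_left (min_le_right _ _) 1)
    rw [show 2 * ((κ + 2 : ℕ) : ℝ) - 2 = 2 * (κ + 1) by push_cast; ring,
      ← sub_lt_iff_lt_add, lt_div_iff₀ hk'] at h1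
    have : (2 * (κ + 1) * s : ℝ) < n + 2 * (κ + 1) := by linarith
    exact_mod_cast this
  have hD : κ * n ≤ G.adjCount univ univ +
      (2 * c + n % (κ + 1) * (κ + 1 - n % (κ + 1))) := by
    have h1 := SimpleGraph.mul_le_extremalNumber_pathGraph κ n
    have h2 := G.two_mul_card_edgeFinset_eq_adjCount
    omega
  rw [← hX] at hD hn hs₁ hs₂
  rw [show (κ + 2) / 2 - 1 = κ / 2 by omega]
  exact (hN hfree hD hn hs₁ hs₂).imp id
    (SimpleGraph.isContained_disjointCopies_of_le_card_tightComps hfree)
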